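/- **Setting.** Let $L_x,L_y,L_z>0$ and $\Omega=\prod_d[-L_d/2,L_d/2]$, with periodicity in $x,y$ and $z$ free. For $g$ defined on modes $\bm k=(k_x,k_y,k_z)$ with $k_x\in\frac{2\pi}{L_x}\mathbb Z$, $k_y\in\frac{2\pi}{L_y}\mathbb Z$, $k_z\in\mathbb R$, put $$\mathcal L[g]=\frac1{2\pi L_xL_y}\sum_{k_x,k_y}\int_{\mathbb R}g(\bm k)\,dk_z .$$ Let $w_0,\dots,w_m\ge0$ and $s_0,\dots,s_m>0$ be the weights and bandwidths of the mid-range Gaussians $w_\ell e^{-r^2/s_\ell^2}$, and let $\widehat\tau(\bm k)/|\bm k|^2=\frac{\sqrt\pi}{4}\sum_{\ell=0}^m w_\ell s_\ell^3e^{-s_\ell^2|\bm k|^2/4}$ (extended continuously to $\bm k=0$). Choose integers $I_d\ge1$, odd integers $\mathcal P_d\ge3$ and $\mathcal S>0$, and put $h_d=L_d/I_d$ and $H_d=(\mathcal P_d-1)h_d/2$, so that $\mathcal P_d=2H_d/h_d+1$. Let $W(\bm x)=\prod_d e^{-\mathcal S(x_d/H_d)^2}$ if $|x_d|\le H_d$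 for all $d$, $W(\bm x)=0$ otherwise, and $\widehat W(\bm k)=\prod_d\sqrt{\pi/\mathcal S}\,H_d\,e^{-k_d^2H_d^2/(4\mathcal S)}$. Fix a grid $\{\bm o+\bm n\circ\bm h:\bm n\in\mathbb Z^3\}$ with arbitrary origin $\bm o$, where $\circ$ is the componentwise product. For charges $q_1,\dots,q_N$ at $\bm r_1,\dots,\bm r_N\in\Omega$ let $\overline{\bm r}_j$ be the grid point nearest to $\bm r_j$, and let $$\widehat S_{\rm scal}(\bm k)=\frac{\widehat\tau(\bm k)}{|\bm k|^2\,\widehat W(\bm k)^2}\sum_{j=1}^N q_j\widehat W(\bm k)e^{-i\bm k\cdot\bm r_j},$$ $$\widehat S^{\mathcal P}_{\rm scal}(\bm k)=\frac{\widehat\tau(\bm k)}{|\bm k|^2\,\widehat W(\bm k)^2}\sum_{j=1}^N q_j\,h_xh_yh_z\sum_{|n_d|\le(\mathcal P_d-1)/2}W(\overline{\bm r}_j+\bm n\circ\bm h-\bm r_j)\,e^{-i\bm k\cdot(\overline{\bm r}_j+\bm n\circ\bm h)} .$$ The gridding/scaling error is $$\mathcal E(\bm r_i)=4\pi\,\mathcal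 L\big[(\widehat S_{\rm scal}-\widehat S^{\mathcal P}_{\rm scal})(\bm k)\,\widehat W(\bm k)\,e^{i\bm k\cdot\bm r_i}\big].$$ Put $\mu_d^\ell=s_\ell^2-H_d^2/\mathcal S$ and $\operatorname{erfc}(x)=\frac2{\sqrt\pi}\int_x^\infty e^{-t^2}dt$. **Theorem.** Let $L_x,L_y,L_z$, $m$, $w_\ell$, $s_\ell$, real numbers $C$, $Q$, and $q_0>0$, $\kappa>0$ be given. There is a constant $K>0$, depending only on these data, such that the following holds for all $\mathcal S$, $I_d$, $\mathcal P_d$, $\bm o$ as above with $$H_d^2/\mathcal S<s_\ell^2,\qquad \mu_d^\ell\ge\kappa s_\ell^2,\qquad(\mathcal P_d-1)^2\ge\kappa\,\mathcal S\qquad(0\le\ell\le m,\ d\in\{x,y,z\}),$$ and for all $N$ and all $q_j\in\mathbb R$, $\bm r_j\in\Omega$ such that no two particles coincide up to the periodicity in $x,y$, all charges satisfy $|q_j|\le Q$, all non-zero charges satisfy $|q_j|\ge q_0$, and the Debye–Hückel bound $$\Big|\sum_{j=1}^Nq_je^{i\bm k\cdot(\bm r_i-\bm r_j)}\Big|\le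 C\,Q$$ holds for every $i$ and every mode $\bm k\in\frac{2\pi}{L_x}\mathbb Z\times\frac{2\pi}{L_y}\mathbb Z\times\mathbb R$. For every $i$, the integrals and the series that define $\mathcal E(\bm r_i)$ converge absolutely, and $$|\mathcal E(\bm r_i)|\le K\left(\max_{d\in\{x,y,z\}}\sum_{\ell=0}^m w_\ell\exp\!\Big(-\frac{\pi^2\mu_d^\ell(\mathcal P_d-1)^2}{4s_\ell^2\mathcal S}\Big)+\operatorname{erfc}(\sqrt{\mathcal S})\right).$$ Every admissible window (one with $H_d^2/\mathcal S<s_\ell^2$ for all $d,\ell$) satisfies the two conditions on $\kappa$ for some $\kappa>0$. -/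

import Mathlib

namespace MidRangeSolver

noncomputable section

/-- The complementary error function. -/
def erfc (x : ℝ) : ℝ :=
  2 / Real.sqrt Real.pi * ∫ t in Set.Ioi x, Real.exp (-t ^ 2)

/-- The dot product of two vectors of `ℝ³`; coordinates `0, 1, 2` are `x, y, z`. -/
def dot (a b : Fin 3 → ℝ) : ℝ := ∑ d, a d * b d

/-- The plane wave value `exp (i k · x)`. -/
def planeWave (k x : Fin 3 → ℝ) : ℂ := Complex.exp (Complex.I * (dot k x : ℂ))

/-- The mode `(2π n₁ / L_x, 2π n₂ / L_y, k_z)`, discrete in the periodic directions `x, y` and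
continuous in the free direction `z`. -/
def mode (L : Fin 3 → ℝ) (n : ℤ × ℤ) (kz : ℝ) : Fin 3 → ℝ :=
  ![2 * Real.pi * n.1 / L 0, 2 * Real.pi * n.2 / L 1, kz]

/-- The 2-periodic summation functional
`g ↦ (2π L_x L_y)⁻¹ ∑_{(k_x, k_y)} ∫_ℝ g (k_x, k_y, k_z) dk_z`. -/
def perSum (L : Fin 3 → ℝ) (g : (Fin 3 → ℝ) → ℂ) : ℂ :=
  (1 / (2 * Real.pi * L 0 * L 1) : ℝ) * ∑' n : ℤ × ℤ, ∫ kz : ℝ, g (mode L n kz)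

/-- Absolute convergence of the integrals and of the series in `perSum L g`. -/
def PerSumConverges (L : Fin 3 → ℝ) (g : (Fin 3 → ℝ) → ℂ) : Prop :=
  (∀ n : ℤ × ℤ, MeasureTheory.Integrable (fun kz : ℝ => g (mode L n kz))) ∧
    Summable (fun n : ℤ × ℤ => ∫ kz : ℝ, ‖g (mode L n kz)‖)

/-- Fourier transform of the mid-range screening function of the Gaussians
`w ℓ * exp (-r ^ 2 / s ℓ ^ 2)`, `ℓ = 0, …, m`. -/
def tauHat {m : ℕ} (w s : Fin (m + 1) → ℝ) (k : Fin 3 → ℝ) : ℝ :=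
  Real.sqrt Real.pi / 4 *
    ∑ l, w l * s l ^ 3 * dot k k * Real.exp (-(s l ^ 2 * dot k k) / 4)

/-- The quotient `tauHat k / |k|²`, extended continuously to `k = 0`. -/
def tauHatDivSq {m : ℕ} (w s : Fin (m + 1) → ℝ) (k : Fin 3 → ℝ) : ℝ :=
  Real.sqrt Real.pi / 4 * ∑ l, w l * s l ^ 3 * Real.exp (-(s l ^ 2 * dot k k) / 4)

theorem tauHat_div {m : ℕ} (w s : Fin (m + 1) → ℝ) (k : Fin 3 → ℝ) (hk : dot k k ≠ 0) :
    tauHat w s k / dot k k = tauHatDivSq w s k := by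
  rw [div_eq_iff hk]
  simp only [tauHat, tauHatDivSq, mul_assoc, Finset.sum_mul]
  congr 1
  refine Finset.sum_congr rfl fun l _ => ?_
  ring

/-- The grid size `h_d = L_d / I_d`. -/
def gridSize (L : Fin 3 → ℝ) (I : Fin 3 → ℕ) (d : Fin 3) : ℝ := L d / I d

/-- The half support `H_d = (P_d - 1) h_d / 2` of the window. -/
def halfSupport (L : Fin 3 → ℝ) (I P : Fin 3 → ℕ) (d : Fin 3) : ℝ :=
  ((P d : ℝ) - 1) * gridSize L I d / 2

open Classical in
/-- The truncated Gaussian window with shape parameter `S` and half support `H` in one variable. -/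
def window1 (S H x : ℝ) : ℝ := if |x| ≤ H then Real.exp (-S * (x / H) ^ 2) else 0

/-- The function used as the transform of the Gaussian window in one variable. -/
def windowHat1 (S H k : ℝ) : ℝ :=
  Real.sqrt (Real.pi / S) * H * Real.exp (-(k ^ 2 * H ^ 2) / (4 * S))

/-- The tensor-product Gaussian window in three variables. -/
def window (S : ℝ) (H x : Fin 3 → ℝ) : ℝ := ∏ d, window1 S (H d) (x d)

/-- The tensor-product transform of the Gaussian window. -/
def windowHat (S : ℝ) (H k : Fin 3 → ℝ) : ℝ := ∏ d, windowHat1 S (H d) (k d)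

/-- The grid point with (integer) index `n` of the uniform grid with origin `o` and sizes `h`. -/
def gridPoint (o h : Fin 3 → ℝ) (n : Fin 3 → ℤ) (d : Fin 3) : ℝ := o d + n d * h d

/-- The index of the grid point nearest to `x`. -/
def nearestIndex (o h x : Fin 3 → ℝ) (d : Fin 3) : ℤ := round ((x d - o d) / h d)

/-- The index offsets `|n_d| ≤ (P_d - 1) / 2` of the `P_x P_y P_z` grid points that are used for
one particle. -/
def stencil (P : Fin 3 → ℕ) : Finset (Fin 3 → ℤ) :=
  Fintype.piFinset fun d => Finset.Icc (-(((P d - 1) / 2 : ℕ) : ℤ)) (((P d - 1) / 2 : ℕ) : ℤ)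

/-- The exact transform `∑ⱼ qⱼ Ŵ(k) exp (-i k · rⱼ)` of the gridding function. -/
def sGridHat {N : ℕ} (S : ℝ) (H : Fin 3 → ℝ) (q : Fin N → ℝ) (r : Fin N → Fin 3 → ℝ)
    (k : Fin 3 → ℝ) : ℂ :=
  ∑ j, (q j : ℂ) * (windowHat S H k : ℂ) * planeWave (-k) (r j)

/-- The discrete counterpart of `sGridHat`: the discrete Fourier sum (trapezoidal rule with cell
volume `h_x h_y h_z`) of the gridding function sampled on the grid with the truncated window. -/
def sGridHatDisc {N : ℕ} (S : ℝ) (L o : Fin 3 → ℝ) (I P : Fin 3 → ℕ) (q : Fin N → ℝ)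
    (r : Fin N → Fin 3 → ℝ) (k : Fin 3 → ℝ) : ℂ :=
  ∑ j, (q j : ℂ) * (((∏ d, gridSize L I d : ℝ) : ℂ) * ∑ n ∈ stencil P,
    (window S (halfSupport L I P)
      (gridPoint o (gridSize L I) (nearestIndex o (gridSize L I) (r j) + n) - r j) : ℂ) *
    planeWave (-k) (gridPoint o (gridSize L I) (nearestIndex o (gridSize L I) (r j) + n)))

/-- The scaling step: multiplication by `(tauHat k / |k|²) |Ŵ(k)|⁻²`. -/
def scaling {m : ℕ} (w s : Fin (m + 1) → ℝ) (S : ℝ) (H : Fin 3 → ℝ)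
    (F : (Fin 3 → ℝ) → ℂ) (k : Fin 3 → ℝ) : ℂ :=
  ((tauHatDivSq w s k / windowHat S H k ^ 2 : ℝ) : ℂ) * F k

/-- The integrand `(Ŝ_scal(k) - Ŝ_scal^P(k)) Ŵ(k) exp (i k · x)` of the gridding/scaling error. -/
def scalErrorIntegrand {m N : ℕ} (w s : Fin (m + 1) → ℝ) (S : ℝ) (L o : Fin 3 → ℝ)
    (I P : Fin 3 → ℕ) (q : Fin N → ℝ) (r : Fin N → Fin 3 → ℝ) (x k : Fin 3 → ℝ) : ℂ :=
  (scaling w s S (halfSupport L I P) (sGridHat S (halfSupport L I P) q r) k -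
      scaling w s S (halfSupport L I P) (sGridHatDisc S L o I P q r) k) *
    (windowHat S (halfSupport L I P) k : ℂ) * planeWave k x

/-- The gridding/scaling error of the mid-range potential at the point `x`. -/
def scalError {m N : ℕ} (w s : Fin (m + 1) → ℝ) (S : ℝ) (L o : Fin 3 → ℝ)
    (I P : Fin 3 → ℕ) (q : Fin N → ℝ) (r : Fin N → Fin 3 → ℝ) (x : Fin 3 → ℝ) : ℂ :=
  4 * Real.pi * perSum L (scalErrorIntegrand w s S L o I P q r x)

/-- `μ_d^ℓ = s_ℓ² - H_d² / S`. -/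
def mu (S H s : ℝ) : ℝ := s ^ 2 - H ^ 2 / S

/-- The Debye–Hückel bound on the charge sums, with constant `C` and charge scale `Q`:
`|∑ⱼ qⱼ exp (i k · (rᵢ - rⱼ))| ≤ C Q` for every particle `i` and every mode `k`. -/
def DebyeHuckelBound {N : ℕ} (L : Fin 3 → ℝ) (q : Fin N → ℝ) (r : Fin N → Fin 3 → ℝ)
    (C Q : ℝ) : Prop :=
  ∀ (i : Fin N) (n : ℤ × ℤ) (kz : ℝ),
    ‖∑ j, (q j : ℂ) * planeWave (mode L n kz) (r i - r j)‖ ≤ C * Q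

/-- No two particles coincide up to the periodicity in `x` and `y`. -/
def DistinctModPeriod {N : ℕ} (L : Fin 3 → ℝ) (r : Fin N → Fin 3 → ℝ) : Prop :=
  ∀ i j : Fin N, i ≠ j → ∀ a b : ℤ, r i ≠ r j + ![a * L 0, b * L 1, 0]

end

end MidRangeSolver

open MeasureTheory Filter Topology

namespace MidRangeSolver

noncomputable section

/-! ### Gaussian sums and integrals with a uniform bound in the centre -/

/-! For one particle, the discrete transform is the exact one times a product over the coordinates
of factors `gridRatio`, written ρ_d(k_d), which depend on the particle only through its offset u
from the grid. All powers of Ŵ then cancel (`scalErrorIntegrand_eq`), leaving Σ_j q_j (τ̂/|k|²)(1 -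
∏ ρ_d) e^{ik·(r_i - r_j)}.

In one variable, with H = p h, Poisson summation gives ρ - 1 = aliasing - truncation. The zero
Poisson mode is exactly 1. Against the factor e^{-s²k²/4} of τ̂/|k|², completing the square turns
the n-th alias into a shifted Gaussian times e^{-c n²}, where c = π² μ (P-1)²/(4 s² S) is the
exponent claimed. Truncation leaves the Gaussian tail beyond p divided by Ŵ. The growth of 1/Ŵ is
absorbed because μ ≥ κ s² > 0, and what remains is of order erfc(√S) + (√S/p) e^{-S}. The last term
is controlled by e^{-c} or by erfc(√S), according to the size of S/p (`exists_truncation_le`). This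
yields `exists_lintegral_gridRatio_sub_one_le`.

In three variables, telescoping 1 - ∏ ρ_d leaves products with one small factor each. The mode
functional factorizes, so the one-dimensional estimates multiply (`exists_lintegral_mode_le`).

Since the offset varies with j, the Debye–Hückel sum does not factor out of the error. It is used
through its mean square instead: averaging |Σ_j q_j e^{ik·(r_i - r_j)}|² over modes bounds Σ q_j² by
(CQ)² (`sum_charge_sq_le`), and the lower bound q₀ on non-zero charges turns this into Σ |q_j| ≤
(CQ)²/q₀. An estimate uniform in each particle then suffices. -/

theorem summable_exp_neg_mul_int_add_sq {b : ℝ} (hb : 0 < b) (u : ℝ) :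
    Summable fun n : ℤ => Real.exp (-b * (n + u) ^ 2) := by
  have h := HurwitzKernelBounds.summable_f_int 0 u (t := b / Real.pi) (by positivity)
  refine h.congr fun n => ?_
  simp only [HurwitzKernelBounds.f_int, pow_zero, one_mul]
  congr 1
  field_simp

/-- The measure `ν` integrates every Gaussian of a fixed width, uniformly in its centre. -/
def GaussBounded (ν : Measure ℝ) : Prop :=
  ∀ b : ℝ, 0 < b → ∃ B : ℝ, 0 ≤ B ∧
    ∀ x : ℝ, ∫⁻ k, ENNReal.ofReal (Real.exp (-b * (k + x) ^ 2)) ∂ν ≤ ENNReal.ofReal B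

theorem gaussBounded_volume : GaussBounded volume := by
  intro b hb
  refine ⟨Real.sqrt (Real.pi / b), Real.sqrt_nonneg _, fun x => ?_⟩
  rw [lintegral_add_right_eq_self (fun k => ENNReal.ofReal (Real.exp (-b * k ^ 2))) x,
    ← ofReal_integral_eq_lintegral_ofReal (integrable_exp_neg_mul_sq hb)
      (ae_of_all _ fun _ => (Real.exp_pos _).le), integral_gaussian]

/-- The counting measure of the lattice `δ ℤ`. -/
def latticeMeasure (δ : ℝ) : Measure ℝ :=
  Measure.map (fun n : ℤ => δ * n) Measure.count

theorem lintegral_latticeMeasure (δ : ℝ) {f : ℝ → ENNReal} (hf : Measurable f) :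
    ∫⁻ k, f k ∂(latticeMeasure δ) = ∑' n : ℤ, f (δ * n) := by
  rw [latticeMeasure, lintegral_map hf (measurable_from_top), lintegral_count]

/-- Shifting the summation index by the integer nearest to x/δ leaves a centre of size at most 1/2,
so one centred Gaussian series dominates for all x. -/
theorem gaussBounded_latticeMeasure {δ : ℝ} (hδ : 0 < δ) : GaussBounded (latticeMeasure δ) := by
  intro b hb
  set c : ℝ := b * δ ^ 2 with hc
  have hc0 : 0 < c := by positivity
  have hsum : Summable fun n : ℤ => Real.exp (c / 4) * Real.exp (-(c / 2) * (n + 0) ^ 2) :=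
    (summable_exp_neg_mul_int_add_sq (b := c / 2) (by positivity) 0).mul_left _
  refine ⟨∑' n : ℤ, Real.exp (c / 4) * Real.exp (-(c / 2) * (n + 0) ^ 2),
    tsum_nonneg fun _ => by positivity, fun x => ?_⟩
  rw [lintegral_latticeMeasure _ (by fun_prop), ENNReal.ofReal_tsum_of_nonneg
    (fun _ => by positivity) hsum]
  set N : ℤ := round (x / δ)
  have hN : |x / δ - N| ≤ 1 / 2 := abs_sub_round _
  have hN2 : (x / δ - N) ^ 2 ≤ 1 / 4 := by
    nlinarith [abs_le.1 hN]
  rw [← (Equiv.subRight N).tsum_eq]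
  refine ENNReal.tsum_le_tsum fun n => ENNReal.ofReal_le_ofReal ?_
  rw [← Real.exp_add, Real.exp_le_exp]
  have hx : δ * ((Equiv.subRight N n : ℤ) : ℝ) + x = δ * (n + (x / δ - N)) := by
    simp only [Equiv.subRight_apply, Int.cast_sub]
    field_simp
    ring
  rw [hx]
  have e : -b * (δ * (n + (x / δ - N))) ^ 2 = -(c * (n + (x / δ - N)) ^ 2) := by
    rw [hc]; ring
  rw [e]
  set f := x / δ - N
  -- (n + f)² ≥ n²/2 - f², because (n + 2f)² ≥ 0; and f² ≤ 1/4.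
  nlinarith [mul_nonneg hc0.le (sq_nonneg ((n : ℝ) + 2 * f)), mul_le_mul_of_nonneg_left hN2 hc0.le]

/-! ### Poisson summation for the sampled Gaussian -/

/-- Expanding the square in n makes the left side a theta series with a complex linear term, and the
functional equation of that series gives the dual sum. -/
theorem poisson_gaussian {b : ℝ} (hb : 0 < b) (u θ : ℝ) :
    ∑' n : ℤ, Complex.exp (-(b * (n + u) ^ 2) - Complex.I * (θ * (n + u))) =
      (Real.sqrt (Real.pi / b) : ℂ) * ∑' n : ℤ,
        Complex.exp (-((θ + 2 * Real.pi * n) ^ 2 / (4 * b)) +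
          Complex.I * (2 * Real.pi * n * u)) := by
  have hpi : (Real.pi : ℂ) ≠ 0 := by exact_mod_cast Real.pi_ne_zero
  have hbC : (b : ℂ) ≠ 0 := by exact_mod_cast hb.ne'
  have hI : Complex.I ^ 2 = -1 := Complex.I_sq
  have ha : 0 < ((b / Real.pi : ℝ) : ℂ).re := by
    rw [Complex.ofReal_re]; positivity
  have key := Complex.tsum_exp_neg_quadratic ha
    (-(b * u / Real.pi) - Complex.I * θ / (2 * Real.pi))
  have hroot : 1 / ((b / Real.pi : ℝ) : ℂ) ^ (1 / 2 : ℂ) = (Real.sqrt (Real.pi / b) : ℂ) := by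
    have : (1 / 2 : ℂ) = ((1 / 2 : ℝ) : ℂ) := by norm_num
    rw [this, ← Complex.ofReal_cpow (by positivity), ← Real.sqrt_eq_rpow, ← Complex.ofReal_one,
      ← Complex.ofReal_div, one_div, ← Real.sqrt_inv, inv_div]
  rw [hroot] at key
  have hl : ∀ n : ℤ, Complex.exp (-(b * (n + u) ^ 2) - Complex.I * (θ * (n + u))) =
      Complex.exp (-(b * u ^ 2) - Complex.I * (θ * u)) *
      Complex.exp (-Real.pi * ((b / Real.pi : ℝ) : ℂ) * n ^ 2 + 2 * Real.pi *
        (-(b * u / Real.pi) - Complex.I * θ / (2 * Real.pi)) * n) := by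
    intro n
    rw [← Complex.exp_add]
    congr 1
    push_cast
    field_simp
    ring
  have hr : ∀ n : ℤ, Complex.exp (-((θ + 2 * Real.pi * n) ^ 2 / (4 * b)) +
          Complex.I * (2 * Real.pi * n * u)) =
      Complex.exp (-(b * u ^ 2) - Complex.I * (θ * u)) *
      Complex.exp (-Real.pi / ((b / Real.pi : ℝ) : ℂ) * (n + Complex.I *
        (-(b * u / Real.pi) - Complex.I * θ / (2 * Real.pi))) ^ 2) := by
    intro n
    rw [← Complex.exp_add]
    congr 1
    push_cast
    field_simp
    ring_nf
    simp only [hI, show Complex.I ^ 3 = -Complex.I by rw [pow_succ, hI]; ring,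
      show Complex.I ^ 4 = 1 by rw [show 4 = 2 * 2 by rfl, pow_mul, hI]; ring]
    ring
  simp_rw [hl, hr]
  rw [tsum_mul_left, key, tsum_mul_left]
  ring

theorem norm_poisson_right (b u θ : ℝ) (n : ℤ) :
    ‖Complex.exp (-((θ + 2 * Real.pi * n) ^ 2 / (4 * b)) +
      Complex.I * (2 * Real.pi * n * u))‖ = Real.exp (-((θ + 2 * Real.pi * n) ^ 2 / (4 * b))) := by
  have : (-((θ + 2 * Real.pi * n) ^ 2 / (4 * b)) + Complex.I * (2 * Real.pi * n * u) : ℂ) =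
      ((-((θ + 2 * Real.pi * n) ^ 2 / (4 * b)) : ℝ) : ℂ) +
        Complex.I * ((2 * Real.pi * n * u : ℝ) : ℂ) := by push_cast; ring
  rw [this, Complex.norm_exp, Complex.add_re, Complex.ofReal_re, Complex.I_mul_re,
    Complex.ofReal_im, neg_zero, add_zero]

theorem norm_poisson_left (b u θ : ℝ) (n : ℤ) :
    ‖Complex.exp (-(b * (n + u) ^ 2) - Complex.I * (θ * (n + u)))‖ =
      Real.exp (-b * (n + u) ^ 2) := by
  have : (-(b * (n + u) ^ 2) - Complex.I * (θ * (n + u)) : ℂ) =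
      ((-b * (n + u) ^ 2 : ℝ) : ℂ) - Complex.I * ((θ * (n + u) : ℝ) : ℂ) := by push_cast; ring
  rw [this, Complex.norm_exp, Complex.sub_re, Complex.ofReal_re, Complex.I_mul_re,
    Complex.ofReal_im, neg_zero, sub_zero]

theorem summable_poisson_left {b : ℝ} (hb : 0 < b) (u θ : ℝ) :
    Summable fun n : ℤ => Complex.exp (-(b * (n + u) ^ 2) - Complex.I * (θ * (n + u))) := by
  refine Summable.of_norm ?_
  simp_rw [norm_poisson_left]
  exact summable_exp_neg_mul_int_add_sq hb u

theorem summable_poisson_right {b : ℝ} (hb : 0 < b) (u θ : ℝ) :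
    Summable fun n : ℤ => Complex.exp (-((θ + 2 * Real.pi * n) ^ 2 / (4 * b)) +
      Complex.I * (2 * Real.pi * n * u)) := by
  refine Summable.of_norm ?_
  simp_rw [norm_poisson_right]
  refine (summable_exp_neg_mul_int_add_sq (b := Real.pi ^ 2 / b) (by positivity)
    (θ / (2 * Real.pi))).congr fun n => ?_
  congr 1
  have := Real.pi_pos
  field_simp
  ring

/-- The discrete transform of the truncated window, sampled at `(n + u) h` for `|n| ≤ p`, relative
to the transform `windowHat1` of the Gaussian. -/
def gridRatio (S H h : ℝ) (p : ℕ) (u k : ℝ) : ℂ :=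
  ((h / windowHat1 S H k : ℝ) : ℂ) * ∑ n ∈ Finset.Icc (-(p : ℤ)) p,
    (window1 S H ((n + u) * h) : ℂ) * Complex.exp (-(Complex.I * (k * ((n + u) * h))))

theorem windowHat1_pos {S H : ℝ} (hS : 0 < S) (hH : 0 < H) (k : ℝ) : 0 < windowHat1 S H k := by
  unfold windowHat1
  have := Real.pi_pos
  positivity

/-- As |u| ≤ 1/2, every integer with |n + u| ≤ p already satisfies |n| ≤ p. The finite stencil
therefore misses no sample in the support of the window, and the sum is the full Gaussian series
minus its tail. -/
theorem sum_window_eq {S h : ℝ} {p : ℕ} {u : ℝ} (hS : 0 < S) (hh : 0 < h) (hp : 0 < p)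
    (hu : |u| ≤ 1 / 2) (k : ℝ) :
    (∑ n ∈ Finset.Icc (-(p : ℤ)) p,
      (window1 S (p * h) ((n + u) * h) : ℂ) * Complex.exp (-(Complex.I * (k * ((n + u) * h))))) =
    (∑' n : ℤ, Complex.exp (-((S / p ^ 2 : ℝ) * (n + u) ^ 2) -
        Complex.I * ((k * h : ℝ) * (n + u)))) -
      ∑' n : ℤ, if |(n : ℝ) + u| ≤ p then 0 else
        Complex.exp (-((S / p ^ 2 : ℝ) * (n + u) ^ 2) - Complex.I * ((k * h : ℝ) * (n + u))) := by
  have hp' : (0 : ℝ) < p := by exact_mod_cast hp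
  have hb : 0 < S / (p : ℝ) ^ 2 := by positivity
  set G : ℤ → ℂ := fun n => Complex.exp (-((S / p ^ 2 : ℝ) * (n + u) ^ 2) -
    Complex.I * ((k * h : ℝ) * (n + u))) with hG
  have hsG : Summable G := summable_poisson_left hb u (k * h)
  have hs2 : Summable fun n : ℤ => if |(n : ℝ) + u| ≤ p then 0 else G n := by
    refine (hsG.indicator {n : ℤ | ¬ |(n : ℝ) + u| ≤ p}).congr fun n => ?_
    simp only [Set.indicator, Set.mem_ofPred_eq]
    split_ifs <;> simp_all
  rw [← hsG.tsum_sub hs2, tsum_eq_sum (s := Finset.Icc (-(p : ℤ)) p)]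
  · refine Finset.sum_congr rfl fun n _ => ?_
    have hiff : |((n : ℝ) + u) * h| ≤ p * h ↔ |(n : ℝ) + u| ≤ p := by
      rw [abs_mul, abs_of_pos hh, mul_le_mul_iff_left₀ hh]
    simp only [window1, hiff]
    split_ifs with hn
    · rw [sub_zero, hG, Complex.ofReal_exp, ← Complex.exp_add]
      congr 1
      have : (p : ℂ) ≠ 0 := by exact_mod_cast hp.ne'
      have : (h : ℂ) ≠ 0 := by exact_mod_cast hh.ne'
      push_cast
      field_simp
      ring
    · simp
  · intro n hn
    rw [if_neg, sub_self]
    intro hle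
    refine hn (Finset.mem_Icc.2 ?_)
    have h1 := abs_le.1 hu
    have h2 := abs_le.1 hle
    constructor
    · have : (-(p : ℝ)) - 1 < n := by linarith
      have : (-(p : ℤ)) - 1 < n := by exact_mod_cast this
      omega
    · have : (n : ℝ) < p + 1 := by linarith
      have : n < (p : ℤ) + 1 := by exact_mod_cast this
      omega

theorem enorm_gridRatio_sub_one_le {S h : ℝ} {p : ℕ} {u : ℝ} (hS : 0 < S) (hh : 0 < h) (hp : 0 < p)
    (hu : |u| ≤ 1 / 2) (k : ℝ) :
    ‖gridRatio S (p * h) h p u k - 1‖ₑ ≤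
      (∑' n : ℤ, if n = 0 then 0 else ENNReal.ofReal (Real.exp
        (k ^ 2 * (p * h) ^ 2 / (4 * S) - (k + 2 * Real.pi * n / h) ^ 2 * (p * h) ^ 2 / (4 * S)))) +
      ENNReal.ofReal (h / windowHat1 S (p * h) k) *
        ∑' n : ℤ, if |(n : ℝ) + u| ≤ p then 0 else
          ENNReal.ofReal (Real.exp (-(S / p ^ 2) * (n + u) ^ 2)) := by
  have hp' : (0 : ℝ) < p := by exact_mod_cast hp
  have hb : 0 < S / (p : ℝ) ^ 2 := by positivity
  have hpi := Real.pi_pos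
  -- The Poisson prefactor divided by the window transform is exactly the exponential that
  -- normalizes the term n = 0 to 1.
  have hpre : h / windowHat1 S (p * h) k * Real.sqrt (Real.pi / (S / p ^ 2)) =
      Real.exp (k ^ 2 * (p * h) ^ 2 / (4 * S)) := by
    have e1 : Real.sqrt (Real.pi / (S / p ^ 2)) = Real.sqrt (Real.pi / S) * p := by
      rw [div_div_eq_mul_div, mul_div_right_comm, Real.sqrt_mul (by positivity),
        Real.sqrt_sq hp'.le]
    rw [e1, windowHat1, neg_div, Real.exp_neg]
    have : 0 < Real.sqrt (Real.pi / S) := by positivity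
    field_simp
  rw [gridRatio, sum_window_eq hS hh hp hu, mul_sub, poisson_gaussian hb, ← mul_assoc,
    ← Complex.ofReal_mul, hpre, (summable_poisson_right hb u _).tsum_eq_add_tsum_ite 0, mul_add]
  have h0 : ((Real.exp (k ^ 2 * (p * h) ^ 2 / (4 * S)) : ℝ) : ℂ) *
      Complex.exp (-((((k * h : ℝ) : ℂ) + 2 * Real.pi * ((0 : ℤ) : ℂ)) ^ 2 /
        (4 * ((S / p ^ 2 : ℝ) : ℂ))) + Complex.I * (2 * Real.pi * ((0 : ℤ) : ℂ) * u)) = 1 := by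
    rw [Complex.ofReal_exp, ← Complex.exp_add, Complex.exp_eq_one_iff]
    refine ⟨0, ?_⟩
    have : (p : ℂ) ≠ 0 := by exact_mod_cast hp.ne'
    have : (S : ℂ) ≠ 0 := by exact_mod_cast hS.ne'
    push_cast
    field_simp
    ring
  rw [h0, add_sub_assoc, add_sub_cancel_left]
  refine (enorm_sub_le).trans (add_le_add ?_ ?_)
  · rw [← tsum_mul_left]
    refine (enorm_tsum_le_tsum_enorm).trans (ENNReal.tsum_le_tsum fun n => ?_)
    split_ifs with hn
    · simp
    · rw [← ofReal_norm, norm_mul, norm_poisson_right, Complex.norm_real,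
        Real.norm_of_nonneg (Real.exp_pos _).le, ← Real.exp_add]
      refine ENNReal.ofReal_le_ofReal (le_of_eq ?_)
      congr 1
      field_simp
      ring
  · rw [enorm_mul]
    refine mul_le_mul' (le_of_eq ?_) ?_
    · rw [← ofReal_norm, Complex.norm_real, Real.norm_of_nonneg]
      exact (div_pos hh (windowHat1_pos hS (by positivity) k)).le
    · refine (enorm_tsum_le_tsum_enorm).trans (ENNReal.tsum_le_tsum fun n => ?_)
      split_ifs with hn
      · simp
      · rw [← ofReal_norm, norm_poisson_left]

/-! ### The truncated tail of the sampled Gaussian -/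

theorem integrable_exp_neg_sq : Integrable fun t : ℝ => Real.exp (-t ^ 2) := by
  simpa using integrable_exp_neg_mul_sq (b := 1) one_pos

/-- On the interval from x to x + 1/(1 + x) the exponent t² exceeds x² by at most 3, so that
interval alone carries enough mass. -/
theorem erfc_lower {x : ℝ} (hx : 0 ≤ x) :
    2 / Real.sqrt Real.pi * Real.exp (-3) * Real.exp (-x ^ 2) / (1 + x) ≤ erfc x := by
  have h1 : 0 < 1 + x := by linarith
  set δ : ℝ := 1 / (1 + x) with hδ
  have hδ0 : 0 < δ := by positivity
  have hδ1 : δ ≤ 1 := by rw [hδ, div_le_one h1]; linarith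
  have hxδ : x * δ ≤ 1 := by
    rw [hδ, mul_one_div, div_le_one h1]; linarith
  have key : δ * (Real.exp (-3) * Real.exp (-x ^ 2)) ≤ ∫ t in Set.Ioi x, Real.exp (-t ^ 2) := by
    calc δ * (Real.exp (-3) * Real.exp (-x ^ 2))
        = ∫ _ in Set.Ioc x (x + δ), Real.exp (-3) * Real.exp (-x ^ 2) := by
          rw [setIntegral_const, smul_eq_mul, Measure.real, Real.volume_Ioc, add_sub_cancel_left,
            ENNReal.toReal_ofReal hδ0.le]
      _ ≤ ∫ t in Set.Ioc x (x + δ), Real.exp (-t ^ 2) := by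
          refine setIntegral_mono_on (integrableOn_const (by simp)) integrable_exp_neg_sq.integrableOn
            measurableSet_Ioc fun t ht => ?_
          rw [← Real.exp_add, Real.exp_le_exp]
          nlinarith [ht.1, ht.2]
      _ ≤ ∫ t in Set.Ioi x, Real.exp (-t ^ 2) :=
          setIntegral_mono_set integrable_exp_neg_sq.integrableOn
            (ae_of_all _ fun _ => (Real.exp_pos _).le) Set.Ioc_subset_Ioi_self.eventuallyLE
  rw [erfc, mul_assoc, mul_div_assoc]
  refine mul_le_mul_of_nonneg_left (le_trans (le_of_eq ?_) key) (by positivity)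
  rw [hδ]; ring

theorem erfc_nonneg (x : ℝ) : 0 ≤ erfc x :=
  mul_nonneg (by positivity) (setIntegral_nonneg measurableSet_Ioi fun _ _ => (Real.exp_pos _).le)

theorem erfc_le_one {x : ℝ} (hx : 0 ≤ x) : erfc x ≤ 1 := by
  have h0 : ∫ t in Set.Ioi (0 : ℝ), Real.exp (-t ^ 2) = Real.sqrt Real.pi / 2 := by
    simpa using integral_gaussian_Ioi 1
  have h1 : ∫ t in Set.Ioi x, Real.exp (-t ^ 2) ≤ Real.sqrt Real.pi / 2 := by
    rw [← h0]
    exact setIntegral_mono_set integrable_exp_neg_sq.integrableOn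
      (ae_of_all _ fun _ => (Real.exp_pos _).le) (Set.Ioi_subset_Ioi hx).eventuallyLE
  have hpi : 0 < Real.sqrt Real.pi := by have := Real.pi_pos; positivity
  calc erfc x ≤ 2 / Real.sqrt Real.pi * (Real.sqrt Real.pi / 2) :=
        mul_le_mul_of_nonneg_left h1 (by positivity)
    _ = 1 := by field_simp

theorem integral_Ioi_gaussian_eq_erfc {c : ℝ} (hc : 0 < c) (p : ℝ) :
    ∫ x in Set.Ioi p, Real.exp (-(c * x) ^ 2) = Real.sqrt Real.pi / 2 / c * erfc (c * p) := by
  rw [integral_comp_mul_left_Ioi (fun t => Real.exp (-t ^ 2)) p hc, erfc, smul_eq_mul]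
  have : 0 < Real.sqrt Real.pi := by have := Real.pi_pos; positivity
  field_simp

theorem tsum_gaussian_nat_le {b : ℝ} (hb : 0 < b) {p : ℝ} (hp : 0 ≤ p) :
    (∑' i : ℕ, ENNReal.ofReal (Real.exp (-b * (p + (i + 1 : ℕ)) ^ 2))) ≤
      ENNReal.ofReal (∫ x in Set.Ioi p, Real.exp (-b * x ^ 2)) := by
  refine ENNReal.tsum_le_of_sum_range_le fun a => ?_
  rw [← ENNReal.ofReal_sum_of_nonneg fun _ _ => (Real.exp_pos _).le]
  refine ENNReal.ofReal_le_ofReal ?_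
  have hanti : AntitoneOn (fun x : ℝ => Real.exp (-b * x ^ 2)) (Set.Icc p (p + a)) := by
    intro x hx y hy hxy
    simp only [Real.exp_le_exp]
    have : x ^ 2 ≤ y ^ 2 := pow_le_pow_left₀ (hp.trans hx.1) hxy 2
    nlinarith
  refine hanti.sum_le_integral.trans ?_
  rw [intervalIntegral.integral_of_le (by simp)]
  exact setIntegral_mono_set (integrable_exp_neg_mul_sq hb).integrableOn
    (ae_of_all _ fun _ => (Real.exp_pos _).le) Set.Ioc_subset_Ioi_self.eventuallyLE

theorem tsum_int_natAbs_le (F : ℕ → ENNReal) : ∑' n : ℤ, F n.natAbs ≤ 2 * ∑' n : ℕ, F n := by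
  rw [tsum_of_nat_of_neg_add_one ENNReal.summable ENNReal.summable, two_mul]
  refine add_le_add (le_of_eq (by simp)) ?_
  have : ∀ n : ℕ, (-((n : ℤ) + 1)).natAbs = n + 1 := fun n => by omega
  simp_rw [this]
  exact ENNReal.tsum_comp_le_tsum_of_injective (add_left_injective 1) F

theorem tsum_tail_le {S : ℝ} {p : ℕ} {u : ℝ} (hS : 0 < S) (hp : 0 < p) (hu : |u| ≤ 1 / 2) :
    (∑' n : ℤ, if |(n : ℝ) + u| ≤ p then 0 else
      ENNReal.ofReal (Real.exp (-(S / p ^ 2) * (n + u) ^ 2))) ≤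
    ENNReal.ofReal (4 * Real.exp (-S) + Real.sqrt Real.pi * p / Real.sqrt S *
      erfc (Real.sqrt S)) := by
  have hp' : (0 : ℝ) < p := by exact_mod_cast hp
  set b : ℝ := S / p ^ 2 with hbdef
  have hb : 0 < b := by positivity
  have hbp : b * (p : ℝ) ^ 2 = S := by rw [hbdef]; field_simp
  -- Majorant in N = |n|: |n + u| > p forces N ≥ p, and |n + u| ≥ N - 1. The values N = p and N = p
  -- + 1 each contribute e^{-S}; from N = p + 2 on, the samples p + 1, p + 2, … are compared with
  -- the integral over (p, ∞). The two signs of n double everything.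
  let F : ℕ → ENNReal := fun N => if N < p then 0 else
    ENNReal.ofReal (Real.exp (-b * (max (p : ℝ) (N - 1)) ^ 2))
  have hF : ∀ n : ℤ, (if |(n : ℝ) + u| ≤ p then 0 else
      ENNReal.ofReal (Real.exp (-b * (n + u) ^ 2))) ≤ F n.natAbs := by
    intro n
    split_ifs with hn
    · exact zero_le
    · push Not at hn
      have hcast : ((n.natAbs : ℕ) : ℝ) = |(n : ℝ)| := by
        rw [← Int.cast_abs, Int.abs_eq_natAbs]; simp
      have h1 : |(n : ℝ) + u| ≤ |(n : ℝ)| + 1 / 2 := (abs_add_le _ _).trans (by linarith)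
      have h2 : |(n : ℝ)| - 1 ≤ |(n : ℝ) + u| := by
        have := abs_sub_abs_le_abs_sub (n : ℝ) (-u)
        rw [abs_neg, sub_neg_eq_add] at this
        linarith
      have h3 : ¬ n.natAbs < p := by
        intro hlt
        have : ((n.natAbs + 1 : ℕ) : ℝ) ≤ p := by exact_mod_cast hlt
        push_cast [hcast] at this
        linarith
      simp only [F, if_neg h3]
      refine ENNReal.ofReal_le_ofReal (Real.exp_le_exp.2 ?_)
      have h4 : max (p : ℝ) (n.natAbs - 1) ≤ |(n : ℝ) + u| := max_le hn.le (by rw [hcast]; exact h2)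
      have h5 : (max (p : ℝ) (n.natAbs - 1)) ^ 2 ≤ ((n : ℝ) + u) ^ 2 := by
        rw [← sq_abs ((n : ℝ) + u)]
        exact pow_le_pow_left₀ (hp'.le.trans (le_max_left _ _)) h4 2
      nlinarith
  have hsumF : ∑' N, F N ≤ ENNReal.ofReal (2 * Real.exp (-S)) +
      ENNReal.ofReal (∫ x in Set.Ioi (p : ℝ), Real.exp (-b * x ^ 2)) := by
    rw [← Summable.sum_add_tsum_nat_add' (k := p + 2) ENNReal.summable]
    refine add_le_add ?_ ?_
    · have hz : ∑ i ∈ Finset.range p, F i = 0 :=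
        Finset.sum_eq_zero fun i hi => if_pos (Finset.mem_range.1 hi)
      rw [Finset.sum_range_succ, Finset.sum_range_succ, hz, zero_add, two_mul,
        ENNReal.ofReal_add (Real.exp_pos _).le (Real.exp_pos _).le]
      have e1 : F p = ENNReal.ofReal (Real.exp (-S)) := by
        simp only [F, if_neg (lt_irrefl p)]
        rw [max_eq_left (by linarith), neg_mul, hbp]
      have e2 : F (p + 1) = ENNReal.ofReal (Real.exp (-S)) := by
        simp only [F, if_neg (show ¬ p + 1 < p by omega)]
        rw [max_eq_left (by push_cast; linarith), neg_mul, hbp]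
      rw [e1, e2]
    · refine le_trans (le_of_eq ?_) (tsum_gaussian_nat_le hb hp'.le)
      refine tsum_congr fun i => ?_
      simp only [F, if_neg (show ¬ i + (p + 2) < p by omega)]
      rw [max_eq_right (by push_cast; linarith [(Nat.cast_nonneg i : (0 : ℝ) ≤ i)])]
      congr 4
      push_cast
      ring
  have hsq : Real.sqrt S ^ 2 = S := Real.sq_sqrt hS.le
  have hs0 : 0 < Real.sqrt S := Real.sqrt_pos.2 hS
  have hint : ∫ x in Set.Ioi (p : ℝ), Real.exp (-b * x ^ 2) =
      Real.sqrt Real.pi / 2 / (Real.sqrt S / p) * erfc (Real.sqrt S) := by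
    have h := integral_Ioi_gaussian_eq_erfc (c := Real.sqrt S / p) (by positivity) p
    rw [div_mul_cancel₀ _ hp'.ne'] at h
    rw [← h]
    congr 1
    ext x
    rw [mul_pow, div_pow, hsq, neg_mul]
  refine (ENNReal.tsum_le_tsum hF).trans ((tsum_int_natAbs_le F).trans ?_)
  refine (mul_le_mul_right hsumF 2).trans (le_of_eq ?_)
  have := erfc_nonneg (Real.sqrt S)
  rw [hint, ← ENNReal.ofReal_add (by positivity) (by positivity),
    ← ENNReal.ofReal_ofNat 2, ← ENNReal.ofReal_mul (by norm_num)]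
  congr 1
  field_simp
  ring

/-! ### The one-dimensional error estimate -/

/-- The boundary term (√S/p) e^{-S} is not bounded by erfc(√S) alone, since erfc(√S) behaves like
e^{-S}/√S for large S; the aliasing exponential covers the range where S/p is large. -/
theorem exists_truncation_le {κ : ℝ} (hκ : 0 < κ) :
    ∃ K : ℝ, 0 ≤ K ∧ ∀ (S p c : ℝ), 0 < S → 0 < p → κ * S ≤ (2 * p) ^ 2 →
      c ≤ Real.pi ^ 2 * p ^ 2 / S →
      Real.sqrt S / p * Real.exp (-S) ≤ K * (Real.exp (-c) + erfc (Real.sqrt S)) := by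
  have hpi := Real.pi_pos
  have hspi : 0 < Real.sqrt Real.pi := Real.sqrt_pos.2 hpi
  have hsκ : 0 < Real.sqrt κ := Real.sqrt_pos.2 hκ
  set α : ℝ := 2 / Real.sqrt κ with hα
  have hα0 : 0 < α := by positivity
  set β : ℝ := (α + Real.pi) * (Real.sqrt Real.pi / 2 * Real.exp 3) with hβ
  have hβ0 : 0 < β := by positivity
  refine ⟨α + β, by positivity, fun S p c hS hp hκS hc => ?_⟩
  have hsS : 0 < Real.sqrt S := Real.sqrt_pos.2 hS
  have hsq : Real.sqrt S ^ 2 = S := Real.sq_sqrt hS.le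
  have he := erfc_nonneg (Real.sqrt S)
  have hratio : Real.sqrt S / p ≤ α := by
    rw [hα, div_le_div_iff₀ hp hsκ, ← Real.sqrt_mul hS.le, mul_comm S κ]
    exact Real.sqrt_le_iff.2 ⟨by positivity, hκS⟩
  have hec := Real.exp_pos (-c)
  -- If S ≥ πp then S ≥ π²p²/S ≥ c, so e^{-S} ≤ e^{-c}. If S ≤ πp then (√S/p)(1 + √S) is bounded and
  -- `erfc_lower` applies.
  rcases le_total (Real.pi * p) S with h | h
  · have h1 : Real.exp (-S) ≤ Real.exp (-c) := by
      refine Real.exp_le_exp.2 (neg_le_neg (hc.trans ?_))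
      rw [div_le_iff₀ hS]
      nlinarith [mul_pos hpi hp]
    calc Real.sqrt S / p * Real.exp (-S) ≤ α * Real.exp (-c) :=
          mul_le_mul hratio h1 (Real.exp_pos _).le hα0.le
      _ ≤ (α + β) * (Real.exp (-c) + erfc (Real.sqrt S)) := by
          nlinarith [mul_nonneg hα0.le he, mul_nonneg hβ0.le he, mul_pos hβ0 hec]
  · have h1 : Real.sqrt S / p * (1 + Real.sqrt S) ≤ α + Real.pi := by
      have : Real.sqrt S / p * Real.sqrt S ≤ Real.pi := by
        rw [div_mul_eq_mul_div, ← sq, hsq, div_le_iff₀ hp]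
        exact h
      linarith
    have h2 := erfc_lower hsS.le
    rw [hsq] at h2
    have h3 : Real.exp (-S) / (1 + Real.sqrt S) ≤
        Real.sqrt Real.pi / 2 * Real.exp 3 * erfc (Real.sqrt S) := by
      refine le_trans (le_of_eq ?_) (mul_le_mul_of_nonneg_left h2 (by positivity))
      rw [Real.exp_neg 3]
      have := Real.exp_pos 3
      field_simp
    calc Real.sqrt S / p * Real.exp (-S)
        = Real.sqrt S / p * (1 + Real.sqrt S) * (Real.exp (-S) / (1 + Real.sqrt S)) := by
          field_simp
      _ ≤ (α + Real.pi) * (Real.sqrt Real.pi / 2 * Real.exp 3 * erfc (Real.sqrt S)) :=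
          mul_le_mul h1 h3 (by positivity) (by positivity)
      _ = β * erfc (Real.sqrt S) := by rw [hβ]; ring
      _ ≤ (α + β) * (Real.exp (-c) + erfc (Real.sqrt S)) := by
          nlinarith [mul_nonneg hα0.le he, mul_pos hβ0 hec, mul_pos hα0 hec]

/-- For n ≠ 0 and c ≥ c₀, c n² - c ≥ c₀(n² - 1): the leading alias dominates with a constant
depending only on c₀. -/
theorem exists_tsum_exp_le {c₀ : ℝ} (hc₀ : 0 < c₀) :
    ∃ M : ℝ, 0 ≤ M ∧ ∀ c : ℝ, c₀ ≤ c →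
      (∑' n : ℤ, if n = 0 then 0 else ENNReal.ofReal (Real.exp (-c * n ^ 2))) ≤
        ENNReal.ofReal (M * Real.exp (-c)) := by
  have hs : Summable fun n : ℤ => Real.exp c₀ * Real.exp (-c₀ * (n + 0) ^ 2) :=
    (summable_exp_neg_mul_int_add_sq hc₀ 0).mul_left _
  refine ⟨∑' n : ℤ, Real.exp c₀ * Real.exp (-c₀ * (n + 0) ^ 2),
    tsum_nonneg fun _ => by positivity, fun c hc => ?_⟩
  rw [← tsum_mul_right, ENNReal.ofReal_tsum_of_nonneg (fun _ => by positivity) (hs.mul_right _)]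
  refine ENNReal.tsum_le_tsum fun n => ?_
  split_ifs with hn
  · exact zero_le
  · refine ENNReal.ofReal_le_ofReal ?_
    rw [← Real.exp_add, ← Real.exp_add, Real.exp_le_exp]
    have h1 : (1 : ℝ) ≤ (n : ℝ) ^ 2 := by
      have : (1 : ℤ) ≤ n ^ 2 := by have := pow_pos (abs_pos.2 hn) 2; rw [sq_abs] at this; omega
      exact_mod_cast this
    nlinarith

theorem exists_lintegral_gridRatio_sub_one_le {ν : Measure ℝ} (hν : GaussBounded ν) {s κ : ℝ}
    (hs : 0 < s) (hκ : 0 < κ) :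
    ∃ K : ℝ, 0 ≤ K ∧ ∀ (S h u : ℝ) (p : ℕ), 0 < S → 0 < h → 0 < p → |u| ≤ 1 / 2 →
      κ * s ^ 2 ≤ mu S (p * h) s → κ * S ≤ (2 * p : ℝ) ^ 2 →
      ∫⁻ k, ENNReal.ofReal (Real.exp (-(s ^ 2 * k ^ 2) / 4)) *
          ‖gridRatio S (p * h) h p u k - 1‖ₑ ∂ν ≤
        ENNReal.ofReal (K * (Real.exp (-(Real.pi ^ 2 * mu S (p * h) s * (2 * p : ℝ) ^ 2) /
          (4 * s ^ 2 * S)) + erfc (Real.sqrt S))) := by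
  have hpi := Real.pi_pos
  have hspi : 0 < Real.sqrt Real.pi := Real.sqrt_pos.2 hpi
  obtain ⟨B, hB0, hB⟩ := hν (s ^ 2 / 4) (by positivity)
  obtain ⟨B', hB'0, hB'⟩ := hν (κ * s ^ 2 / 4) (by positivity)
  obtain ⟨T, hT0, hT⟩ := exists_truncation_le hκ
  -- This is the lower bound for c that results from μ ≥ κ s² and (2p)² ≥ κ S.
  obtain ⟨M, hM0, hM⟩ := exists_tsum_exp_le (c₀ := Real.pi ^ 2 * κ ^ 2 / 4) (by positivity)
  refine ⟨B * M + B' * (4 / Real.sqrt Real.pi * T + 1), by positivity,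
    fun S h u p hS hh hp hu hμ hκS => ?_⟩
  have hp' : (0 : ℝ) < p := by exact_mod_cast hp
  have hsS : 0 < Real.sqrt S := Real.sqrt_pos.2 hS
  have hsq : Real.sqrt S ^ 2 = S := Real.sq_sqrt hS.le
  set μ := mu S (p * h) s with hμdef
  have hμ0 : 0 < μ := lt_of_lt_of_le (by positivity) hμ
  have hμs : μ ≤ s ^ 2 := by
    rw [hμdef, mu]
    have : 0 ≤ (p * h) ^ 2 / S := by positivity
    linarith
  set c : ℝ := Real.pi ^ 2 * μ * (2 * p : ℝ) ^ 2 / (4 * s ^ 2 * S) with hc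
  rw [neg_div, ← hc]
  have hcle : c ≤ Real.pi ^ 2 * p ^ 2 / S := by
    rw [hc, div_le_div_iff₀ (by positivity) hS]
    have : 0 ≤ Real.pi ^ 2 * (2 * p : ℝ) ^ 2 * S := by positivity
    nlinarith
  have hc0 : Real.pi ^ 2 * κ ^ 2 / 4 ≤ c := by
    rw [hc, div_le_div_iff₀ (by norm_num) (by positivity)]
    have := mul_le_mul hμ hκS (by positivity) hμ0.le
    have := mul_le_mul_of_nonneg_left this (show 0 ≤ 4 * Real.pi ^ 2 by positivity)
    nlinarith
  have he := erfc_nonneg (Real.sqrt S)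
  -- the aliasing part
  have hA : ∫⁻ k, ENNReal.ofReal (Real.exp (-(s ^ 2 * k ^ 2) / 4)) *
      (∑' n : ℤ, if n = 0 then 0 else ENNReal.ofReal (Real.exp
        (k ^ 2 * (p * h) ^ 2 / (4 * S) -
          (k + 2 * Real.pi * n / h) ^ 2 * (p * h) ^ 2 / (4 * S)))) ∂ν ≤
      ENNReal.ofReal (B * M * Real.exp (-c)) := by
    -- Completing the square in k. The centre moves with n, which is why the Gaussian bound must be
    -- uniform in the centre.
    have hpt : ∀ k : ℝ, ENNReal.ofReal (Real.exp (-(s ^ 2 * k ^ 2) / 4)) *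
        (∑' n : ℤ, if n = 0 then 0 else ENNReal.ofReal (Real.exp
          (k ^ 2 * (p * h) ^ 2 / (4 * S) -
            (k + 2 * Real.pi * n / h) ^ 2 * (p * h) ^ 2 / (4 * S)))) =
        ∑' n : ℤ, ENNReal.ofReal (Real.exp (-(s ^ 2 / 4) *
          (k + (p * h) ^ 2 / S * (2 * Real.pi * n / h) / s ^ 2) ^ 2)) *
          (if n = 0 then 0 else ENNReal.ofReal (Real.exp (-c * n ^ 2))) := by
      intro k
      rw [← ENNReal.tsum_mul_left]
      refine tsum_congr fun n => ?_
      split_ifs with hn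
      · simp
      · rw [← ENNReal.ofReal_mul (Real.exp_pos _).le, ← ENNReal.ofReal_mul (Real.exp_pos _).le,
          ← Real.exp_add, ← Real.exp_add]
        congr 2
        rw [hc, hμdef, mu]
        field_simp
        ring
    simp_rw [hpt]
    rw [lintegral_tsum fun n => by fun_prop]
    calc _ ≤ ∑' n : ℤ, ENNReal.ofReal B *
          (if n = 0 then 0 else ENNReal.ofReal (Real.exp (-c * n ^ 2))) := by
          refine ENNReal.tsum_le_tsum fun n => ?_
          rw [lintegral_mul_const _ (by fun_prop)]
          exact mul_le_mul_left (hB _) _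
      _ ≤ ENNReal.ofReal (B * M * Real.exp (-c)) := by
          rw [ENNReal.tsum_mul_left, mul_assoc, ENNReal.ofReal_mul hB0]
          exact mul_le_mul_right (hM c hc0) _
  -- the truncation part
  have hR : ∫⁻ k, ENNReal.ofReal (Real.exp (-(s ^ 2 * k ^ 2) / 4)) *
      (ENNReal.ofReal (h / windowHat1 S (p * h) k) *
        ∑' n : ℤ, if |(n : ℝ) + u| ≤ p then 0 else
          ENNReal.ofReal (Real.exp (-(S / p ^ 2) * (n + u) ^ 2))) ∂ν ≤
      ENNReal.ofReal (B' * ((4 / Real.sqrt Real.pi * T + 1) *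
        (Real.exp (-c) + erfc (Real.sqrt S)))) := by
    set X : ℝ := 4 * Real.exp (-S) + Real.sqrt Real.pi * p / Real.sqrt S * erfc (Real.sqrt S)
      with hX
    have hX0 : 0 ≤ X := by positivity
    have hpt : ∀ k : ℝ, ENNReal.ofReal (Real.exp (-(s ^ 2 * k ^ 2) / 4)) *
        (ENNReal.ofReal (h / windowHat1 S (p * h) k) *
          ∑' n : ℤ, if |(n : ℝ) + u| ≤ p then 0 else
            ENNReal.ofReal (Real.exp (-(S / p ^ 2) * (n + u) ^ 2))) ≤
        ENNReal.ofReal (Real.exp (-(κ * s ^ 2 / 4) * (k + 0) ^ 2)) *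
          ENNReal.ofReal (Real.sqrt S / (Real.sqrt Real.pi * p) * X) := by
      intro k
      refine (mul_le_mul_right (mul_le_mul_right (tsum_tail_le hS hp hu) _) _).trans ?_
      have hW := windowHat1_pos hS (by positivity : 0 < p * h) k
      rw [← ENNReal.ofReal_mul (by positivity), ← ENNReal.ofReal_mul (Real.exp_pos _).le,
        ← ENNReal.ofReal_mul (Real.exp_pos _).le]
      refine ENNReal.ofReal_le_ofReal ?_
      rw [← mul_assoc, ← mul_assoc]
      refine mul_le_mul_of_nonneg_right ?_ hX0
      have e1 : h / windowHat1 S (p * h) k = Real.sqrt S / (Real.sqrt Real.pi * p) *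
          Real.exp (k ^ 2 * (p * h) ^ 2 / (4 * S)) := by
        rw [windowHat1, neg_div, Real.exp_neg, Real.sqrt_div hpi.le]
        field_simp
      rw [e1, mul_left_comm, mul_comm (Real.exp (-(κ * s ^ 2 / 4) * (k + 0) ^ 2))]
      refine mul_le_mul_of_nonneg_left ?_ (by positivity)
      rw [← Real.exp_add, Real.exp_le_exp]
      -- After division by the window transform the decay rate in k drops from s² to μ.
      have : -(s ^ 2 * k ^ 2) / 4 + k ^ 2 * (p * h) ^ 2 / (4 * S) = -(μ * k ^ 2 / 4) := by
        rw [hμdef, mu]; field_simp; ring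
      rw [this]
      nlinarith [mul_le_mul_of_nonneg_right hμ (sq_nonneg k)]
    refine (lintegral_mono hpt).trans ?_
    rw [lintegral_mul_const _ (by fun_prop)]
    refine (mul_le_mul_left (hB' 0) _).trans ?_
    rw [← ENNReal.ofReal_mul hB'0]
    refine ENNReal.ofReal_le_ofReal (mul_le_mul_of_nonneg_left ?_ hB'0)
    have e2 : Real.sqrt S / (Real.sqrt Real.pi * p) * X =
        4 / Real.sqrt Real.pi * (Real.sqrt S / p * Real.exp (-S)) + erfc (Real.sqrt S) := by
      rw [hX]; field_simp
    rw [e2]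
    have h1 := mul_le_mul_of_nonneg_left (hT S p c hS hp' hκS hcle)
      (show 0 ≤ 4 / Real.sqrt Real.pi by positivity)
    have := (Real.exp_pos (-c)).le
    nlinarith
  calc _ ≤ ∫⁻ k, (ENNReal.ofReal (Real.exp (-(s ^ 2 * k ^ 2) / 4)) *
      (∑' n : ℤ, if n = 0 then 0 else ENNReal.ofReal (Real.exp
        (k ^ 2 * (p * h) ^ 2 / (4 * S) -
          (k + 2 * Real.pi * n / h) ^ 2 * (p * h) ^ 2 / (4 * S)))) +
      ENNReal.ofReal (Real.exp (-(s ^ 2 * k ^ 2) / 4)) *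
      (ENNReal.ofReal (h / windowHat1 S (p * h) k) *
        ∑' n : ℤ, if |(n : ℝ) + u| ≤ p then 0 else
          ENNReal.ofReal (Real.exp (-(S / p ^ 2) * (n + u) ^ 2)))) ∂ν := by
        refine lintegral_mono fun k => ?_
        rw [← mul_add]
        exact mul_le_mul_right (enorm_gridRatio_sub_one_le hS hh hp hu k) _
    _ ≤ _ := by
        rw [lintegral_add_left]
        · refine (add_le_add hA hR).trans ?_
          have := (Real.exp_pos (-c)).le
          rw [← ENNReal.ofReal_add (by positivity) (by positivity)]
          refine ENNReal.ofReal_le_ofReal ?_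
          nlinarith [mul_nonneg (mul_nonneg hB0 hM0) he]
        · refine Measurable.mul (by fun_prop) (Measurable.tsum fun n => ?_)
          split_ifs
          · exact measurable_const
          · fun_prop

/-! ### The Debye–Hückel bound controls the total charge -/

theorem tendsto_cesaro_pow {z : ℂ} (hz : ‖z‖ = 1) :
    Tendsto (fun M : ℕ => (M : ℂ)⁻¹ * ∑ n ∈ Finset.range M, z ^ n) atTop
      (𝓝 (if z = 1 then 1 else 0)) := by
  split_ifs with h
  · refine tendsto_const_nhds.congr' ?_
    filter_upwards [eventually_gt_atTop 0] with M hM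
    have : (M : ℂ) ≠ 0 := by exact_mod_cast hM.ne'
    simp [h, this]
  · refine squeeze_zero_norm (a := fun M : ℕ => (2 / ‖z - 1‖) * (M : ℝ)⁻¹) (fun M => ?_) ?_
    · rw [geom_sum_eq h, norm_mul, norm_inv, Complex.norm_natCast, norm_div, mul_comm]
      refine mul_le_mul_of_nonneg_right ?_ (by positivity)
      refine div_le_div_of_nonneg_right ?_ (norm_nonneg _)
      refine (norm_sub_le _ _).trans ?_
      rw [norm_pow, hz, one_pow, norm_one]
      norm_num
    · simpa using (tendsto_inv_atTop_nhds_zero_nat (𝕜 := ℝ)).const_mul (2 / ‖z - 1‖)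

/-- A trigonometric polynomial on `ℕ^D` with distinct frequencies that is bounded by `B` has square
sum of coefficients at most `B ^ 2`. -/
theorem sum_sq_le_of_trigPoly_bounded {N D : ℕ} (q : Fin N → ℝ) (z : Fin N → Fin D → ℂ)
    (hz : ∀ j d, ‖z j d‖ = 1) (hinj : Function.Injective z) {B : ℝ}
    (hB : ∀ n : Fin D → ℕ, ‖∑ j, (q j : ℂ) * ∏ d, z j d ^ n d‖ ≤ B) :
    ∑ j, q j ^ 2 ≤ B ^ 2 := by
  have hconj : ∀ j l d, z j d * (starRingEnd ℂ) (z l d) = 1 ↔ z j d = z l d := by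
    intro j l d
    have h1 : z l d * (starRingEnd ℂ) (z l d) = 1 := by
      rw [Complex.mul_conj, Complex.normSq_eq_norm_sq, hz]; simp
    have h2 : (starRingEnd ℂ) (z l d) ≠ 0 := right_ne_zero_of_mul_eq_one h1
    rw [← h1, mul_left_inj' h2]
  -- Expanding the squared modulus and averaging over the box {0, …, M-1}^D: each pair (j, l)
  -- contributes a product of one-dimensional Cesàro means, which tends to 1 for equal frequencies
  -- and to 0 otherwise.
  have havg : ∀ M : ℕ, ∑ j, ∑ l, (q j : ℂ) * q l *
      ∏ d, ((M : ℂ)⁻¹ * ∑ n ∈ Finset.range M, (z j d * (starRingEnd ℂ) (z l d)) ^ n) =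
      ((M : ℂ)⁻¹) ^ D * ∑ n ∈ Fintype.piFinset (fun _ : Fin D => Finset.range M),
        ((‖∑ j, (q j : ℂ) * ∏ d, z j d ^ n d‖ ^ 2 : ℝ) : ℂ) := by
    intro M
    have hsq : ∀ n : Fin D → ℕ, ((‖∑ j, (q j : ℂ) * ∏ d, z j d ^ n d‖ ^ 2 : ℝ) : ℂ) =
        ∑ j, ∑ l, (q j : ℂ) * q l * ∏ d, (z j d * (starRingEnd ℂ) (z l d)) ^ n d := by
      intro n
      rw [← Complex.normSq_eq_norm_sq, ← Complex.mul_conj, map_sum, Finset.sum_mul_sum]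
      refine Finset.sum_congr rfl fun j _ => Finset.sum_congr rfl fun l _ => ?_
      simp only [map_mul, map_prod, map_pow, Complex.conj_ofReal, mul_pow, Finset.prod_mul_distrib]
      ring
    simp_rw [hsq]
    conv_rhs => rw [Finset.sum_comm, Finset.mul_sum]
    refine Finset.sum_congr rfl fun j _ => ?_
    conv_rhs => rw [Finset.sum_comm, Finset.mul_sum]
    refine Finset.sum_congr rfl fun l _ => ?_
    rw [Finset.prod_mul_distrib, Finset.prod_const, Finset.card_univ, Fintype.card_fin,
      Finset.prod_univ_sum, ← Finset.mul_sum]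
    ring
  have hlim : Tendsto (fun M : ℕ => ∑ j, ∑ l, (q j : ℂ) * q l *
      ∏ d, ((M : ℂ)⁻¹ * ∑ n ∈ Finset.range M, (z j d * (starRingEnd ℂ) (z l d)) ^ n)) atTop
      (𝓝 (∑ j, ∑ l, (q j : ℂ) * q l *
        ∏ d, (if z j d * (starRingEnd ℂ) (z l d) = 1 then (1 : ℂ) else 0))) := by
    refine tendsto_finsetSum _ fun j _ => tendsto_finsetSum _ fun l _ =>
      Tendsto.const_mul _ (tendsto_finsetProd _ fun d _ => tendsto_cesaro_pow ?_)
    rw [norm_mul, RCLike.norm_conj, hz, hz, one_mul]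
  have hval : (∑ j, ∑ l, (q j : ℂ) * q l *
        ∏ d, (if z j d * (starRingEnd ℂ) (z l d) = 1 then (1 : ℂ) else 0)) =
      ((∑ j, q j ^ 2 : ℝ) : ℂ) := by
    rw [Complex.ofReal_sum]
    refine Finset.sum_congr rfl fun j _ => ?_
    rw [Finset.sum_eq_single j]
    · rw [Finset.prod_eq_one fun d _ => if_pos ((hconj j j d).2 rfl)]
      push_cast
      ring
    · intro l _ hl
      obtain ⟨d, hd⟩ := Function.ne_iff.1 (hinj.ne hl)
      rw [Finset.prod_eq_zero (Finset.mem_univ d) (if_neg fun h => hd ((hconj j l d).1 h).symm),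
        mul_zero]
    · simp
  rw [hval] at hlim
  have hle := le_of_tendsto hlim.norm (b := B ^ 2) (by
    filter_upwards [eventually_gt_atTop 0] with M hM
    have hM' : (0 : ℝ) < M := by exact_mod_cast hM
    rw [havg, norm_mul, norm_pow, norm_inv, Complex.norm_natCast, inv_pow, inv_mul_le_iff₀
      (by positivity)]
    refine (norm_sum_le_of_le _ (f := fun n : Fin D → ℕ =>
      ((‖∑ j, (q j : ℂ) * ∏ d, z j d ^ n d‖ ^ 2 : ℝ) : ℂ)) (n := fun _ => B ^ 2)
      fun n _ => ?_).trans (le_of_eq ?_)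
    · rw [Complex.norm_real, Real.norm_of_nonneg (by positivity)]
      exact pow_le_pow_left₀ (norm_nonneg _) (hB n) 2
    · rw [Finset.sum_const, Fintype.card_piFinset_const, Finset.card_range,
        nsmul_eq_mul]
      push_cast
      ring)
  rw [Complex.norm_real, Real.norm_of_nonneg (Finset.sum_nonneg fun _ _ => sq_nonneg _)] at hle
  exact hle

theorem sum_charge_sq_le {N : ℕ} {L : Fin 3 → ℝ} (hL : ∀ d, 0 < L d) {q : Fin N → ℝ}
    {r : Fin N → Fin 3 → ℝ} (hr : ∀ j d, r j d ∈ Set.Icc (-(L d / 2)) (L d / 2))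
    (hdist : DistinctModPeriod L r) {C Q : ℝ} (hDH : DebyeHuckelBound L q r C Q) (i : Fin N) :
    ∑ j, q j ^ 2 ≤ (C * Q) ^ 2 := by
  have hpi := Real.pi_pos
  -- The free direction is sampled with spacing 1/L_z. Two particles in the box then differ in
  -- z-phase by at most 1 < 2π, so equal phases force equal z; in x and y they force equality up to
  -- a period.
  let f : Fin 3 → ℝ := ![2 * Real.pi / L 0, 2 * Real.pi / L 1, 1 / L 2]
  let z : Fin N → Fin 3 → ℂ := fun j d =>
    Complex.exp (((f d * (r i d - r j d) : ℝ) : ℂ) * Complex.I)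
  refine sum_sq_le_of_trigPoly_bounded q z (fun j d => Complex.norm_exp_ofReal_mul_I _) ?_ ?_
  · intro j l hjl
    by_contra hne
    have hint : ∀ d, ∃ a : ℤ, f d * (r j d - r l d) = a * (2 * Real.pi) := by
      intro d
      have h := congrFun hjl d
      simp only [z] at h
      rw [Complex.exp_eq_exp_iff_exists_int] at h
      obtain ⟨a, ha⟩ := h
      refine ⟨-a, ?_⟩
      have h2 : ((f d * (r i d - r j d) : ℝ) : ℂ) =
          ((f d * (r i d - r l d) + a * (2 * Real.pi) : ℝ) : ℂ) := by
        apply mul_right_cancel₀ Complex.I_ne_zero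
        rw [ha]; push_cast; ring
      have h3 := Complex.ofReal_injective h2
      push_cast
      linarith
    have hxy : ∀ x l a : ℝ, 0 < l → 2 * Real.pi / l * x = a * (2 * Real.pi) → x = a * l := by
      intro x l a hl h
      field_simp at h
      linarith
    obtain ⟨a, ha⟩ := hint 0
    obtain ⟨b, hb⟩ := hint 1
    obtain ⟨c, hc⟩ := hint 2
    have ha' := hxy _ _ _ (hL 0) ha
    have hb' := hxy _ _ _ (hL 1) hb
    have hc' : r j 2 - r l 2 = c * (2 * Real.pi) * L 2 := by
      have h2 := (hL 2).ne'
      have : 1 / L 2 * (r j 2 - r l 2) = c * (2 * Real.pi) := hc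
      field_simp at this
      linarith
    have hc0 : c = 0 := by
      have h1 := hr j 2
      have h2 := hr l 2
      have hab : |(c : ℝ) * (2 * Real.pi) * L 2| ≤ L 2 := by
        rw [← hc', abs_le]
        constructor <;> linarith [h1.1, h1.2, h2.1, h2.2]
      rw [abs_mul, abs_of_pos (hL 2), abs_mul, abs_of_pos (by positivity : 0 < 2 * Real.pi)] at hab
      have h3 : |(c : ℝ)| * (2 * Real.pi) ≤ 1 := by
        by_contra h
        push Not at h
        nlinarith [hL 2]
      have h4 : |(c : ℝ)| < 1 := by nlinarith [Real.pi_gt_three, abs_nonneg (c : ℝ)]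
      have h5 : |c| < 1 := by exact_mod_cast h4
      exact Int.abs_lt_one_iff.1 h5
    refine hdist j l hne a b (funext fun d => ?_)
    rw [hc0] at hc'
    fin_cases d <;> simp at ha' hb' hc' ⊢ <;> linarith
  · intro n
    have h := hDH i (n 0, n 1) (n 2 / L 2)
    refine le_trans (le_of_eq ?_) h
    congr 1
    refine Finset.sum_congr rfl fun j _ => ?_
    congr 1
    simp only [z]
    simp_rw [← Complex.exp_nat_mul]
    rw [← Complex.exp_sum, planeWave]
    congr 1
    simp only [dot, mode, Fin.sum_univ_three, f, Matrix.cons_val_zero, Matrix.cons_val_one,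
      Matrix.cons_val, Pi.sub_apply]
    push_cast
    ring

theorem sum_abs_charge_le {N : ℕ} {q : Fin N → ℝ} {q₀ B : ℝ} (hq₀ : 0 < q₀)
    (hq : ∀ j, q j ≠ 0 → q₀ ≤ |q j|) (h : ∑ j, q j ^ 2 ≤ B) : ∑ j, |q j| ≤ B / q₀ := by
  rw [le_div_iff₀ hq₀, Finset.sum_mul]
  refine (Finset.sum_le_sum fun j _ => ?_).trans h
  rw [← sq_abs, sq]
  by_cases h0 : q j = 0
  · simp [h0]
  · exact mul_le_mul_of_nonneg_left (hq j h0) (abs_nonneg _)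

/-! ### The periodic summation functional -/

/-- Working with lower integrals needs no convergence beforehand: finiteness of the total gives
integrability and summability along with the bound. -/
theorem perSum_bound {L : Fin 3 → ℝ} (hL : ∀ d, 0 < L d) {g : (Fin 3 → ℝ) → ℂ}
    (hg : ∀ n, Measurable fun kz => g (mode L n kz)) {X : ℝ} (hX : 0 ≤ X)
    (h : ∑' n : ℤ × ℤ, ∫⁻ kz, ‖g (mode L n kz)‖ₑ ≤ ENNReal.ofReal X) :
    PerSumConverges L g ∧ ‖perSum L g‖ ≤ 1 / (2 * Real.pi * L 0 * L 1) * X := by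
  have hfin : ∑' n : ℤ × ℤ, ∫⁻ kz, ‖g (mode L n kz)‖ₑ ≠ ⊤ :=
    (h.trans_lt ENNReal.ofReal_lt_top).ne
  have hint : ∀ n, Integrable fun kz => g (mode L n kz) := fun n =>
    ⟨(hg n).aestronglyMeasurable, lt_of_le_of_lt (ENNReal.le_tsum n) hfin.lt_top⟩
  have heq : ∀ n, ∫ kz, ‖g (mode L n kz)‖ = (∫⁻ kz, ‖g (mode L n kz)‖ₑ).toReal := fun n =>
    integral_norm_eq_lintegral_enorm (hint n).aestronglyMeasurable
  have hsum : Summable fun n => ∫ kz, ‖g (mode L n kz)‖ := by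
    simp_rw [heq]
    exact ENNReal.summable_toReal hfin
  have hle : ∑' n, ∫ kz, ‖g (mode L n kz)‖ ≤ X := by
    simp_rw [heq]
    rw [← ENNReal.tsum_toReal_eq fun n => (lt_of_le_of_lt (ENNReal.le_tsum n) hfin.lt_top).ne]
    exact ENNReal.toReal_le_of_le_ofReal hX h
  refine ⟨⟨hint, hsum⟩, ?_⟩
  have hpi := Real.pi_pos
  have h0 := hL 0
  have h1 := hL 1
  rw [perSum, norm_mul, Complex.norm_real, Real.norm_of_nonneg (by positivity)]
  refine mul_le_mul_of_nonneg_left (le_trans ?_ hle) (by positivity)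
  exact tsum_of_norm_bounded hsum.hasSum fun n => norm_integral_le_integral_norm _

/-! ### Factorization over the coordinates -/

/-- The offset, in units of the grid size, between `x` and the nearest grid point. -/
def gridOffset (o h x : Fin 3 → ℝ) (d : Fin 3) : ℝ :=
  nearestIndex o h x d - (x d - o d) / h d

theorem abs_gridOffset_le (o h x : Fin 3 → ℝ) (d : Fin 3) : |gridOffset o h x d| ≤ 1 / 2 := by
  rw [gridOffset, abs_sub_comm]
  exact abs_sub_round _

theorem planeWave_neg (k x : Fin 3 → ℝ) :
    planeWave (-k) x = ∏ d, Complex.exp (-(Complex.I * (k d * x d))) := by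
  rw [planeWave, ← Complex.exp_sum]
  congr 1
  simp only [dot, Pi.neg_apply, Fin.sum_univ_three]
  push_cast
  ring

theorem norm_planeWave (k x : Fin 3 → ℝ) : ‖planeWave k x‖ = 1 := by
  rw [planeWave, mul_comm]
  exact Complex.norm_exp_ofReal_mul_I _

/-- Stencil points are x_d + (n_d + u_d) h_d, with u the grid offset. The plane wave at x factors
out, and the sum over the box stencil is a product of one-dimensional sums. -/
theorem sum_stencil_eq {S : ℝ} {o h H : Fin 3 → ℝ} {P : Fin 3 → ℕ} (hS : 0 < S)
    (hh : ∀ d, 0 < h d) (hH : ∀ d, 0 < H d) (x k : Fin 3 → ℝ) :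
    ((∏ d, h d : ℝ) : ℂ) * ∑ n ∈ stencil P,
      (window S H (gridPoint o h (nearestIndex o h x + n) - x) : ℂ) *
        planeWave (-k) (gridPoint o h (nearestIndex o h x + n)) =
    (windowHat S H k : ℂ) * planeWave (-k) x *
      ∏ d, gridRatio S (H d) (h d) ((P d - 1) / 2) (gridOffset o h x d) (k d) := by
  have hx : ∀ (n : Fin 3 → ℤ) d, gridPoint o h (nearestIndex o h x + n) d =
      x d + (n d + gridOffset o h x d) * h d := by
    intro n d
    have := (hh d).ne'
    simp only [gridPoint, gridOffset, Pi.add_apply, Int.cast_add]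
    field_simp
    ring
  have hterm : ∀ n : Fin 3 → ℤ,
      (window S H (gridPoint o h (nearestIndex o h x + n) - x) : ℂ) *
        planeWave (-k) (gridPoint o h (nearestIndex o h x + n)) =
      planeWave (-k) x * ∏ d, (window1 S (H d) ((n d + gridOffset o h x d) * h d) : ℂ) *
        Complex.exp (-(Complex.I * (k d * ((n d + gridOffset o h x d) * h d)))) := by
    intro n
    rw [planeWave_neg, planeWave_neg, window, Complex.ofReal_prod, ← Finset.prod_mul_distrib,
      ← Finset.prod_mul_distrib]
    refine Finset.prod_congr rfl fun d _ => ?_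
    rw [Pi.sub_apply, hx, add_sub_cancel_left]
    conv_rhs => rw [mul_left_comm, ← Complex.exp_add]
    congr 2
    push_cast
    ring
  simp_rw [hterm, gridRatio]
  rw [← Finset.mul_sum, Finset.prod_mul_distrib, Finset.prod_univ_sum, stencil, windowHat,
    ← Complex.ofReal_prod, Finset.prod_div_distrib]
  have : ((∏ d, windowHat1 S (H d) (k d) : ℝ) : ℂ) ≠ 0 := by
    exact_mod_cast (Finset.prod_pos fun d _ => windowHat1_pos hS (hH d) (k d)).ne'
  push_cast at this ⊢
  field_simp

theorem scalErrorIntegrand_eq {m N : ℕ} (w s : Fin (m + 1) → ℝ) {S : ℝ} {L o : Fin 3 → ℝ}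
    {I P : Fin 3 → ℕ} (hS : 0 < S) (hh : ∀ d, 0 < gridSize L I d)
    (hH : ∀ d, 0 < halfSupport L I P d) (q : Fin N → ℝ) (r : Fin N → Fin 3 → ℝ)
    (x k : Fin 3 → ℝ) :
    scalErrorIntegrand w s S L o I P q r x k = ∑ j, (q j : ℂ) * ((tauHatDivSq w s k : ℂ) *
      (1 - ∏ d, gridRatio S (halfSupport L I P d) (gridSize L I d) ((P d - 1) / 2)
        (gridOffset o (gridSize L I) (r j) d) (k d))) * (planeWave (-k) (r j) * planeWave k x) := by
  have hW : (windowHat S (halfSupport L I P) k : ℂ) ≠ 0 := by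
    exact_mod_cast (Finset.prod_pos fun d _ => windowHat1_pos hS (hH d) (k d)).ne'
  rw [scalErrorIntegrand, scaling, scaling, ← mul_sub, sGridHat, sGridHatDisc,
    ← Finset.sum_sub_distrib, Finset.mul_sum, Finset.sum_mul, Finset.sum_mul]
  refine Finset.sum_congr rfl fun j _ => ?_
  rw [sum_stencil_eq hS hh hH]
  push_cast
  field_simp

theorem measurable_gridRatio (S H h : ℝ) (p : ℕ) (u : ℝ) : Measurable (gridRatio S H h p u) := by
  unfold gridRatio windowHat1
  fun_prop

/-- The measures over which the three coordinates of a mode range. -/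
def modeMeasure (L : Fin 3 → ℝ) : Fin 3 → Measure ℝ :=
  ![latticeMeasure (2 * Real.pi / L 0), latticeMeasure (2 * Real.pi / L 1), volume]

theorem gaussBounded_modeMeasure {L : Fin 3 → ℝ} (hL : ∀ d, 0 < L d) (d : Fin 3) :
    GaussBounded (modeMeasure L d) := by
  have hpi := Real.pi_pos
  have h0 := hL 0
  have h1 := hL 1
  fin_cases d
  · exact gaussBounded_latticeMeasure (by positivity)
  · exact gaussBounded_latticeMeasure (by positivity)
  · exact gaussBounded_volume

theorem tsum_lintegral_mode_prod (L : Fin 3 → ℝ) {f : Fin 3 → ℝ → ENNReal}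
    (hf : ∀ d, Measurable (f d)) :
    ∑' n : ℤ × ℤ, ∫⁻ kz, ∏ d, f d (mode L n kz d) = ∏ d, ∫⁻ k, f d k ∂(modeMeasure L d) := by
  have e : ∀ n : ℤ × ℤ, ∫⁻ kz, ∏ d, f d (mode L n kz d) =
      f 0 (2 * Real.pi / L 0 * n.1) * (f 1 (2 * Real.pi / L 1 * n.2) * ∫⁻ kz, f 2 kz) := by
    intro n
    rw [← mul_assoc, ← lintegral_const_mul _ (hf 2)]
    refine lintegral_congr fun kz => ?_
    rw [Fin.prod_univ_three]
    simp only [mode, Matrix.cons_val_zero, Matrix.cons_val_one, Matrix.cons_val, div_mul_eq_mul_div]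
  simp_rw [e]
  rw [ENNReal.tsum_prod (f := fun a b : ℤ => f 0 (2 * Real.pi / L 0 * a) *
    (f 1 (2 * Real.pi / L 1 * b) * ∫⁻ kz, f 2 kz)), Fin.prod_univ_three]
  simp_rw [ENNReal.tsum_mul_left, ENNReal.tsum_mul_right]
  simp only [modeMeasure, Matrix.cons_val_zero, Matrix.cons_val_one, Matrix.cons_val]
  rw [lintegral_latticeMeasure _ (hf 0), lintegral_latticeMeasure _ (hf 1), mul_assoc]

/-! ### The three-dimensional error estimate -/

/-- Telescoping: 1 - ∏ ρ_d is a sum of three terms, each with one factor ρ_a - 1, and the other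
factors are at most 1 + |ρ_d - 1|. Writing the bound as a sum of products lets each coordinate be
integrated separately. -/
theorem enorm_one_sub_prod_le (ρ : Fin 3 → ℂ) (Φ : Fin 3 → ENNReal) :
    (∏ d, Φ d) * ‖1 - ∏ d, ρ d‖ₑ ≤
      ∑ a, ∏ d, if d = a then Φ d * ‖ρ d - 1‖ₑ else Φ d + Φ d * ‖ρ d - 1‖ₑ := by
  have hρ : ∀ d, ‖ρ d‖ₑ ≤ 1 + ‖ρ d - 1‖ₑ := fun d => by
    calc ‖ρ d‖ₑ = ‖1 + (ρ d - 1)‖ₑ := by rw [add_sub_cancel]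
      _ ≤ ‖(1 : ℂ)‖ₑ + ‖ρ d - 1‖ₑ := enorm_add_le _ _
      _ = 1 + ‖ρ d - 1‖ₑ := by simp
  set e : Fin 3 → ENNReal := fun d => ‖ρ d - 1‖ₑ with he
  have h1 : ‖1 - ∏ d, ρ d‖ₑ ≤ e 0 * (1 + e 1) * (1 + e 2) + (1 + e 0) * e 1 * (1 + e 2) +
      (1 + e 0) * (1 + e 1) * e 2 := by
    have : 1 - ∏ d, ρ d = -((ρ 0 - 1) + ρ 0 * (ρ 1 - 1) + ρ 0 * ρ 1 * (ρ 2 - 1)) := by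
      rw [Fin.prod_univ_three]; ring
    rw [this, enorm_neg]
    refine (enorm_add_le _ _).trans (add_le_add ((enorm_add_le _ _).trans (add_le_add ?_ ?_)) ?_)
    · calc e 0 = e 0 * 1 * 1 := by ring
        _ ≤ _ := by gcongr <;> exact le_self_add
    · rw [enorm_mul]
      calc ‖ρ 0‖ₑ * e 1 = ‖ρ 0‖ₑ * e 1 * 1 := by ring
        _ ≤ _ := by
          gcongr
          · exact hρ 0
          · exact le_self_add
    · rw [enorm_mul, enorm_mul]
      gcongr
      · exact hρ 0
      · exact hρ 1
  refine (mul_le_mul_right h1 _).trans (le_of_eq ?_)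
  simp only [Fin.prod_univ_three, Fin.sum_univ_three, Fin.isValue]
  simp
  ring

theorem exists_lintegral_mode_le {L : Fin 3 → ℝ} (hL : ∀ d, 0 < L d) {s κ : ℝ}
    (hs : 0 < s) (hκ : 0 < κ) :
    ∃ K : ℝ, 0 ≤ K ∧ ∀ (S : ℝ) (h u : Fin 3 → ℝ) (p : Fin 3 → ℕ), 0 < S → (∀ d, 0 < h d) →
      (∀ d, 0 < p d) → (∀ d, |u d| ≤ 1 / 2) → (∀ d, κ * s ^ 2 ≤ mu S (p d * h d) s) →
      (∀ d, κ * S ≤ (2 * p d : ℝ) ^ 2) →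
      ∑' n : ℤ × ℤ, ∫⁻ kz,
        ENNReal.ofReal (Real.exp (-(s ^ 2 * dot (mode L n kz) (mode L n kz)) / 4)) *
          ‖1 - ∏ d, gridRatio S (p d * h d) (h d) (p d) (u d) (mode L n kz d)‖ₑ ≤
        ENNReal.ofReal (K * ∑ d, (Real.exp (-(Real.pi ^ 2 * mu S (p d * h d) s *
          (2 * p d : ℝ) ^ 2) / (4 * s ^ 2 * S)) + erfc (Real.sqrt S))) := by
  choose K hK0 hK using fun d => exists_lintegral_gridRatio_sub_one_le
    (gaussBounded_modeMeasure hL d) hs hκ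
  choose B hB0 hB using fun d => gaussBounded_modeMeasure hL d (s ^ 2 / 4) (by positivity)
  -- G bounds the two factors of each product that need not be small; the 2 is the trivial bound for
  -- an exponential plus erfc.
  set G : ℝ := ∑ d, (B d + K d * 2) with hG
  have hterm0 : ∀ d, 0 ≤ B d + K d * 2 := fun d => by
    have := hK0 d; have := hB0 d; positivity
  have hG0 : 0 ≤ G := Finset.sum_nonneg fun d _ => hterm0 d
  set KK : ℝ := ∑ d, K d with hKK
  have hKK0 : 0 ≤ KK := Finset.sum_nonneg fun d _ => hK0 d
  refine ⟨G ^ 2 * KK, by positivity, fun S h u p hS hh hp hu hμ hκS => ?_⟩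
  set ε : Fin 3 → ℝ := fun d => Real.exp (-(Real.pi ^ 2 * mu S (p d * h d) s *
          (2 * p d : ℝ) ^ 2) / (4 * s ^ 2 * S)) + erfc (Real.sqrt S) with hε
  have hε0 : ∀ d, 0 ≤ ε d := fun d => add_nonneg (Real.exp_pos _).le (erfc_nonneg _)
  have hε2 : ∀ d, ε d ≤ 2 := by
    intro d
    have h1 : Real.exp (-(Real.pi ^ 2 * mu S (p d * h d) s *
          (2 * p d : ℝ) ^ 2) / (4 * s ^ 2 * S)) ≤ 1 := by
      rw [Real.exp_le_one_iff, neg_div, neg_nonpos]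
      have : 0 ≤ mu S (p d * h d) s := le_trans (by positivity) (hμ d)
      positivity
    have h2 := erfc_le_one (Real.sqrt_nonneg S)
    simp only [hε]
    linarith
  let Φ : ℝ → ENNReal := fun k => ENNReal.ofReal (Real.exp (-(s ^ 2 * k ^ 2) / 4))
  have hΦm : Measurable Φ := by fun_prop
  let E : Fin 3 → ℝ → ENNReal := fun d k => Φ k * ‖gridRatio S (p d * h d) (h d) (p d) (u d) k - 1‖ₑ
  have hEm : ∀ d, Measurable (E d) := fun d =>
    hΦm.mul ((measurable_gridRatio _ _ _ _ _).sub_const 1).enorm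
  have hE : ∀ d, ∫⁻ k, E d k ∂(modeMeasure L d) ≤ ENNReal.ofReal (K d * ε d) := fun d =>
    hK d S (h d) (u d) (p d) hS (hh d) (hp d) (hu d) (hμ d) (hκS d)
  have hR : ∀ d, ∫⁻ k, (Φ k + E d k) ∂(modeMeasure L d) ≤ ENNReal.ofReal G := by
    intro d
    rw [lintegral_add_left hΦm]
    have h1 : ∫⁻ k, Φ k ∂(modeMeasure L d) ≤ ENNReal.ofReal (B d) := by
      refine le_trans (le_of_eq (lintegral_congr fun k => ?_)) (hB d 0)
      simp only [Φ]
      congr 2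
      ring
    refine (add_le_add h1 (hE d)).trans ?_
    rw [← ENNReal.ofReal_add (hB0 d) (mul_nonneg (hK0 d) (hε0 d))]
    refine ENNReal.ofReal_le_ofReal ?_
    refine le_trans ?_ (Finset.single_le_sum (fun d _ => hterm0 d) (Finset.mem_univ d))
    have := mul_le_mul_of_nonneg_left (hε2 d) (hK0 d)
    linarith
  let f : Fin 3 → Fin 3 → ℝ → ENNReal := fun a d k => if d = a then E d k else Φ k + E d k
  have hfm : ∀ a d, Measurable (f a d) := by
    intro a d
    by_cases had : d = a
    · simpa only [f, if_pos had] using hEm d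
    · simp only [f, if_neg had]
      exact hΦm.add (hEm d)
  have hpt : ∀ k : Fin 3 → ℝ, ENNReal.ofReal (Real.exp (-(s ^ 2 * dot k k) / 4)) *
      ‖1 - ∏ d, gridRatio S (p d * h d) (h d) (p d) (u d) (k d)‖ₑ ≤ ∑ a, ∏ d, f a d (k d) := by
    intro k
    have : ENNReal.ofReal (Real.exp (-(s ^ 2 * dot k k) / 4)) = ∏ d, Φ (k d) := by
      rw [← ENNReal.ofReal_prod_of_nonneg fun _ _ => (Real.exp_pos _).le, ← Real.exp_sum]
      congr 2
      simp only [dot, Fin.sum_univ_three]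
      ring
    rw [this]
    exact enorm_one_sub_prod_le _ _
  calc _ ≤ ∑' n : ℤ × ℤ, ∫⁻ kz, ∑ a, ∏ d, f a d (mode L n kz d) :=
        ENNReal.tsum_le_tsum fun n => lintegral_mono fun kz => hpt _
    _ = ∑ a, ∑' n : ℤ × ℤ, ∫⁻ kz, ∏ d, f a d (mode L n kz d) := by
        rw [← Summable.tsum_finsetSum fun _ _ => ENNReal.summable]
        refine tsum_congr fun n => lintegral_finsetSum _ fun a _ => ?_
        refine Finset.measurable_fun_prod _ fun d _ => (hfm a d).comp ?_
        fin_cases d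
        · exact measurable_const
        · exact measurable_const
        · exact measurable_id
    _ ≤ ∑ a, ENNReal.ofReal (G ^ 2 * (KK * ε a)) := by
        refine Finset.sum_le_sum fun a _ => ?_
        rw [tsum_lintegral_mode_prod L (hfm a)]
        have hEK : ∀ d, ∫⁻ k, E d k ∂(modeMeasure L d) ≤ ENNReal.ofReal (KK * ε d) := fun d =>
          (hE d).trans (ENNReal.ofReal_le_ofReal (mul_le_mul_of_nonneg_right
            (Finset.single_le_sum (fun d _ => hK0 d) (Finset.mem_univ d)) (hε0 d)))
        have hb : ∀ d, ∫⁻ k, f a d k ∂(modeMeasure L d) ≤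
            if d = a then ENNReal.ofReal (KK * ε d) else ENNReal.ofReal G := by
          intro d
          by_cases had : d = a
          · simpa only [f, if_pos had] using hEK d
          · simpa only [f, if_neg had] using hR d
        refine (Finset.prod_le_prod' fun d _ => hb d).trans (le_of_eq ?_)
        rw [ENNReal.ofReal_mul (by positivity), ENNReal.ofReal_pow hG0, Fin.prod_univ_three]
        fin_cases a <;> simp <;> ring
    _ = _ := by
        rw [← ENNReal.ofReal_sum_of_nonneg fun a _ => by have := hε0 a; positivity]
        congr 1
        rw [Finset.mul_sum]
        exact Finset.sum_congr rfl fun a _ => by ring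

/-! ### The gridding/scaling error -/

theorem halfSupport_eq {L : Fin 3 → ℝ} {I P : Fin 3 → ℕ} (hP : ∀ d, Odd (P d)) (d : Fin 3) :
    halfSupport L I P d = ((P d - 1) / 2 : ℕ) * gridSize L I d ∧
      (P d : ℝ) - 1 = 2 * ((P d - 1) / 2 : ℕ) := by
  obtain ⟨a, ha⟩ := hP d
  have : (P d - 1) / 2 = a := by omega
  rw [halfSupport, this, ha]
  push_cast
  constructor <;> ring

theorem enorm_scalErrorIntegrand_le {m N : ℕ} {w s : Fin (m + 1) → ℝ} (hw : ∀ l, 0 ≤ w l)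
    (hs : ∀ l, 0 < s l) {S : ℝ} {L o : Fin 3 → ℝ} {I P : Fin 3 → ℕ} (hS : 0 < S)
    (hh : ∀ d, 0 < gridSize L I d) (hH : ∀ d, 0 < halfSupport L I P d) (q : Fin N → ℝ)
    (r : Fin N → Fin 3 → ℝ) (x k : Fin 3 → ℝ) :
    ‖scalErrorIntegrand w s S L o I P q r x k‖ₑ ≤
      ∑ j, ∑ l, ENNReal.ofReal (|q j| * (Real.sqrt Real.pi / 4 * (w l * s l ^ 3))) *
        (ENNReal.ofReal (Real.exp (-(s l ^ 2 * dot k k) / 4)) *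
          ‖1 - ∏ d, gridRatio S (halfSupport L I P d) (gridSize L I d) ((P d - 1) / 2)
            (gridOffset o (gridSize L I) (r j) d) (k d)‖ₑ) := by
  rw [scalErrorIntegrand_eq w s hS hh hH]
  refine (enorm_sum_le _ _).trans (Finset.sum_le_sum fun j _ => ?_)
  have hc : ∀ l, 0 ≤ w l * s l ^ 3 := fun l => mul_nonneg (hw l) (pow_pos (hs l) 3).le
  have hτ : ‖(tauHatDivSq w s k : ℂ)‖ₑ = ∑ l, ENNReal.ofReal (Real.sqrt Real.pi / 4 *
      (w l * s l ^ 3)) * ENNReal.ofReal (Real.exp (-(s l ^ 2 * dot k k) / 4)) := by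
    have h0 : 0 ≤ tauHatDivSq w s k := mul_nonneg (by positivity)
      (Finset.sum_nonneg fun l _ => mul_nonneg (hc l) (Real.exp_pos _).le)
    rw [← ofReal_norm, Complex.norm_real, Real.norm_of_nonneg h0, tauHatDivSq, Finset.mul_sum,
      ENNReal.ofReal_sum_of_nonneg fun l _ => mul_nonneg (by positivity)
        (mul_nonneg (hc l) (Real.exp_pos _).le)]
    refine Finset.sum_congr rfl fun l _ => ?_
    rw [← ENNReal.ofReal_mul (mul_nonneg (by positivity) (hc l)), mul_assoc (_ / 4)]
  have hpw : ∀ a b : Fin 3 → ℝ, ‖planeWave a b‖ₑ = 1 := fun a b => by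
    rw [← ofReal_norm, norm_planeWave, ENNReal.ofReal_one]
  rw [enorm_mul, enorm_mul, enorm_mul, enorm_mul, hpw, hpw, hτ, one_mul, mul_one, Finset.sum_mul,
    Finset.mul_sum]
  refine Finset.sum_le_sum fun l _ => le_of_eq ?_
  rw [ENNReal.ofReal_mul (abs_nonneg _), ← ofReal_norm, Complex.norm_real, Real.norm_eq_abs]
  ring

theorem measurable_mode (L : Fin 3 → ℝ) (n : ℤ × ℤ) : Measurable (mode L n) := by
  refine measurable_pi_lambda _ fun d => ?_
  fin_cases d
  · exact measurable_const
  · exact measurable_const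
  · exact measurable_id

theorem measurable_scalErrorIntegrand {m N : ℕ} (w s : Fin (m + 1) → ℝ) (S : ℝ)
    (L o : Fin 3 → ℝ) (I P : Fin 3 → ℕ) (q : Fin N → ℝ) (r : Fin N → Fin 3 → ℝ) (x : Fin 3 → ℝ) :
    Measurable (scalErrorIntegrand w s S L o I P q r x) := by
  unfold scalErrorIntegrand scaling sGridHat sGridHatDisc tauHatDivSq windowHat windowHat1 planeWave
    dot
  simp only [Pi.neg_apply]
  fun_prop

end

end MidRangeSolver

open MidRangeSolver in
theorem mainTheorem1
    -- the box, the mid-range Gaussians, and the data on which the constant may depend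
    (L : Fin 3 → ℝ) (hL : ∀ d, 0 < L d)
    (m : ℕ) (w s : Fin (m + 1) → ℝ) (hw : ∀ l, 0 ≤ w l) (hs : ∀ l, 0 < s l)
    (C Q q₀ : ℝ) (hq₀ : 0 < q₀) (κ : ℝ) (hκ : 0 < κ) :
    ∃ K : ℝ, 0 < K ∧
      -- the window and the grid
      ∀ (S : ℝ) (o : Fin 3 → ℝ) (I P : Fin 3 → ℕ), 0 < S → (∀ d, 0 < I d) →
        (∀ d, Odd (P d) ∧ 3 ≤ P d) →
        (∀ d l, halfSupport L I P d ^ 2 / S < s l ^ 2) →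
        (∀ d l, κ * s l ^ 2 ≤ mu S (halfSupport L I P d) (s l)) →
        (∀ d, κ * S ≤ ((P d : ℝ) - 1) ^ 2) →
        -- the particles
        ∀ (N : ℕ) (q : Fin N → ℝ) (r : Fin N → Fin 3 → ℝ),
          (∀ j d, r j d ∈ Set.Icc (-(L d / 2)) (L d / 2)) →
          DistinctModPeriod L r →
          (∀ j, |q j| ≤ Q) → (∀ j, q j ≠ 0 → q₀ ≤ |q j|) →
          DebyeHuckelBound L q r C Q →
          ∀ i : Fin N,
            PerSumConverges L (scalErrorIntegrand w s S L o I P q r (r i)) ∧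
            ‖scalError w s S L o I P q r (r i)‖ ≤
              K * (Finset.univ.sup' Finset.univ_nonempty (fun d : Fin 3 =>
                    ∑ l, w l * Real.exp
                      (-(Real.pi ^ 2 * mu S (halfSupport L I P d) (s l) * ((P d : ℝ) - 1) ^ 2) /
                        (4 * s l ^ 2 * S)))
                  + erfc (Real.sqrt S)) := by
  have hpi := Real.pi_pos
  have hL0 := hL 0
  have hL1 := hL 1
  choose K hK0 hK using fun l => exists_lintegral_mode_le hL (hs l) hκ
  set D : ℝ := ∑ l, Real.sqrt Real.pi / 4 * s l ^ 3 * K l with hD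
  have hDl : ∀ l, 0 ≤ Real.sqrt Real.pi / 4 * s l ^ 3 * K l := fun l => by
    have := hs l; have := hK0 l; positivity
  have hD0 : 0 ≤ D := Finset.sum_nonneg fun l _ => hDl l
  set W : ℝ := ∑ l, w l with hW
  have hW0 : 0 ≤ W := Finset.sum_nonneg fun l _ => hw l
  set A : ℝ := (C * Q) ^ 2 / q₀ with hA
  have hA0 : 0 ≤ A := by positivity
  -- The final + 1 only keeps the constant positive when the first summand vanishes, for instance
  -- when all weights are zero.
  refine ⟨4 * Real.pi * (1 / (2 * Real.pi * L 0 * L 1) * (A * (D * (3 * (1 + W))))) + 1,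
    by positivity, ?_⟩
  intro S o I P hS hI hP _ hμ hκS N q r hr hdist _ hq hDH i
  have hh : ∀ d, 0 < gridSize L I d := fun d =>
    div_pos (hL d) (by exact_mod_cast hI d)
  have hp : ∀ d, 0 < (P d - 1) / 2 := fun d => by have := (hP d).2; omega
  have hHp : ∀ d, halfSupport L I P d = ((P d - 1) / 2 : ℕ) * gridSize L I d := fun d =>
    (halfSupport_eq (fun d => (hP d).1) d).1
  have hPp : ∀ d, (P d : ℝ) - 1 = 2 * ((P d - 1) / 2 : ℕ) := fun d =>
    (halfSupport_eq (L := L) (I := I) (fun d => (hP d).1) d).2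
  have hH : ∀ d, 0 < halfSupport L I P d := fun d => by
    rw [hHp]; exact mul_pos (by exact_mod_cast hp d) (hh d)
  have hcharge : ∑ j, |q j| ≤ A := sum_abs_charge_le hq₀ hq (sum_charge_sq_le hL hr hdist hDH i)
  set e : Fin 3 → Fin (m + 1) → ℝ := fun d l => Real.exp
    (-(Real.pi ^ 2 * mu S (halfSupport L I P d) (s l) * ((P d : ℝ) - 1) ^ 2) /
      (4 * s l ^ 2 * S)) with he
  have he0 : ∀ d l, 0 ≤ e d l := fun d l => (Real.exp_pos _).le
  set E : ℝ := erfc (Real.sqrt S)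
  have hE0 : 0 ≤ E := erfc_nonneg _
  set M : ℝ := Finset.univ.sup' Finset.univ_nonempty (fun d : Fin 3 => ∑ l, w l * e d l) with hM
  have hMd : ∀ d, ∑ l, w l * e d l ≤ M := fun d =>
    Finset.le_sup' (fun d : Fin 3 => ∑ l, w l * e d l) (Finset.mem_univ d)
  have hM0 : 0 ≤ M :=
    (Finset.sum_nonneg fun l _ => mul_nonneg (hw l) (he0 0 l)).trans (hMd 0)
  have hlint : ∑' n : ℤ × ℤ, ∫⁻ kz,
      ‖scalErrorIntegrand w s S L o I P q r (r i) (mode L n kz)‖ₑ ≤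
      ENNReal.ofReal (A * (D * (3 * (1 + W)) * (M + E))) := by
    let F : Fin N → Fin (m + 1) → (Fin 3 → ℝ) → ENNReal := fun j l k =>
      ENNReal.ofReal (Real.exp (-(s l ^ 2 * dot k k) / 4)) *
          ‖1 - ∏ d, gridRatio S (halfSupport L I P d) (gridSize L I d) ((P d - 1) / 2)
            (gridOffset o (gridSize L I) (r j) d) (k d)‖ₑ
    have hFm : ∀ j l, Measurable (F j l) := by
      intro j l
      refine Measurable.mul (by unfold dot; fun_prop) (Measurable.enorm (Measurable.const_sub
        (Finset.measurable_fun_prod _ fun d _ =>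
          (measurable_gridRatio _ _ _ _ _).comp (measurable_pi_apply d)) 1))
    have hF : ∀ j l, ∑' n : ℤ × ℤ, ∫⁻ kz, F j l (mode L n kz) ≤
        ENNReal.ofReal (K l * ∑ d, (e d l + E)) := by
      intro j l
      have h := hK l S (gridSize L I) (gridOffset o (gridSize L I) (r j)) (fun d => (P d - 1) / 2)
        hS hh hp (abs_gridOffset_le _ _ _) (fun d => by rw [← hHp]; exact hμ d l)
        (fun d => by rw [← hPp]; exact hκS d)
      simp_rw [← hHp, ← hPp] at h
      exact h
    set c : Fin N → Fin (m + 1) → ℝ := fun j l =>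
      |q j| * (Real.sqrt Real.pi / 4 * (w l * s l ^ 3)) with hc
    have hc0 : ∀ j l, 0 ≤ c j l := fun j l => by
      have := hw l; have := hs l; positivity
    have hε0 : ∀ l, 0 ≤ K l * ∑ d, (e d l + E) := fun l =>
      mul_nonneg (hK0 l) (Finset.sum_nonneg fun d _ => add_nonneg (he0 d l) hE0)
    have hreal : ∑ j, ∑ l, c j l * (K l * ∑ d, (e d l + E)) ≤
        A * (D * (3 * (1 + W)) * (M + E)) := by
      -- Each w_l e_{d,l} is one summand of a sum bounded by the maximum M, while erfc carries no
      -- weight in the claim, so w_l ≤ W is absorbed into the constant.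
      have hl : ∀ l, w l * ∑ d, (e d l + E) ≤ 3 * (1 + W) * (M + E) := by
        intro l
        have h1 : ∀ d, w l * e d l ≤ M := fun d =>
          (Finset.single_le_sum (f := fun l => w l * e d l)
            (fun l _ => mul_nonneg (hw l) (he0 d l)) (Finset.mem_univ l)).trans (hMd d)
        have h2 : w l ≤ W := Finset.single_le_sum (fun l _ => hw l) (Finset.mem_univ l)
        rw [Fin.sum_univ_three]
        nlinarith [h1 0, h1 1, h1 2, mul_le_mul_of_nonneg_right h2 hE0, mul_nonneg hW0 hM0]
      have hj : ∀ j, ∑ l, c j l * (K l * ∑ d, (e d l + E)) ≤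
          |q j| * (D * (3 * (1 + W)) * (M + E)) := by
        intro j
        rw [hD, Finset.sum_mul, Finset.sum_mul, Finset.mul_sum]
        refine Finset.sum_le_sum fun l _ => ?_
        have := mul_le_mul_of_nonneg_left (hl l) (mul_nonneg (abs_nonneg (q j)) (hDl l))
        simp only [hc]
        linarith
      refine (Finset.sum_le_sum fun j _ => hj j).trans ?_
      rw [← Finset.sum_mul]
      exact mul_le_mul_of_nonneg_right hcharge (by positivity)
    calc _ ≤ ∑' n : ℤ × ℤ, ∫⁻ kz, ∑ j, ∑ l, ENNReal.ofReal (c j l) * F j l (mode L n kz) :=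
          ENNReal.tsum_le_tsum fun n => lintegral_mono fun kz =>
            enorm_scalErrorIntegrand_le hw hs hS hh hH q r (r i) _
      _ = ∑ j, ∑ l, ENNReal.ofReal (c j l) * ∑' n : ℤ × ℤ, ∫⁻ kz, F j l (mode L n kz) := by
          have hm : ∀ n j l, Measurable fun kz => F j l (mode L n kz) := fun n j l =>
            (hFm j l).comp (measurable_mode L n)
          simp_rw [← ENNReal.tsum_mul_left]
          rw [Finset.sum_congr rfl fun j _ =>
            (Summable.tsum_finsetSum fun _ _ => ENNReal.summable).symm,
            ← Summable.tsum_finsetSum fun _ _ => ENNReal.summable]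
          refine tsum_congr fun n => ?_
          rw [lintegral_finsetSum _ fun j _ => Finset.measurable_fun_sum _ fun l _ =>
            (hm n j l).const_mul _]
          refine Finset.sum_congr rfl fun j _ => ?_
          rw [lintegral_finsetSum _ fun l _ => (hm n j l).const_mul _]
          exact Finset.sum_congr rfl fun l _ => lintegral_const_mul _ (hm n j l)
      _ ≤ ∑ j, ∑ l, ENNReal.ofReal (c j l * (K l * ∑ d, (e d l + E))) := by
          refine Finset.sum_le_sum fun j _ => Finset.sum_le_sum fun l _ => ?_
          rw [ENNReal.ofReal_mul (hc0 j l)]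
          exact mul_le_mul_right (hF j l) _
      _ = ENNReal.ofReal (∑ j, ∑ l, c j l * (K l * ∑ d, (e d l + E))) := by
          rw [ENNReal.ofReal_sum_of_nonneg fun j _ => Finset.sum_nonneg fun l _ =>
            mul_nonneg (hc0 j l) (hε0 l)]
          exact Finset.sum_congr rfl fun j _ =>
            (ENNReal.ofReal_sum_of_nonneg fun l _ => mul_nonneg (hc0 j l) (hε0 l)).symm
      _ ≤ _ := ENNReal.ofReal_le_ofReal hreal
  obtain ⟨hconv, hbound⟩ := perSum_bound hL
    (fun n => (measurable_scalErrorIntegrand w s S L o I P q r (r i)).comp (measurable_mode L n))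
    (by positivity) hlint
  refine ⟨hconv, ?_⟩
  have h4 : ‖(4 * Real.pi : ℂ)‖ = 4 * Real.pi := by
    rw [norm_mul, Complex.norm_real, Real.norm_of_nonneg hpi.le]; simp
  rw [scalError, norm_mul, h4]
  have := mul_le_mul_of_nonneg_left hbound (by positivity : 0 ≤ 4 * Real.pi)
  linarith
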